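/- Let $M$ be a compact connected complex manifold of complex dimension $n\ge 3$ and let $\omega=\sqrt{-1}\,h_{i\bar j}\,dz^i\wedge d\bar z^j$ be (the fundamental form of) a smooth Hermitian metric on $M$. In local holomorphic coordinates, let $$\Theta_{i\bar jk\bar l}=-\frac{\partial^2h_{k\bar l}}{\partial z^i\partial\bar z^j}+h^{p\bar q}\frac{\partial h_{p\bar l}}{\partial\bar z^j}\frac{\partial h_{k\bar q}}{\partial z^i}$$ be the curvature tensor of the Chern connection, where $h^{k\bar l}h_{j\bar l}=\delta_{jk}$. Let $\Theta^{(1)},\Theta^{(3)},\Theta^{(4)}$ be the first, third and fourth Chern–Ricci curvatures, $\Theta^{(a)}=\sqrt{-1}\,\Theta^{(a)}_{i\bar j}\,dz^i\wedge d\bar z^j$ with $$\Theta^{(1)}_{i\bar j}=h^{k\bar l}\Theta_{i\bar jk\bar l},\qquad \Theta^{(3)}_{i\bar j}=h^{k\bar l}\Theta_{i\bar lk\bar j},\qquad \Theta^{(4)}_{i\bar j}=h^{k\bar l}\Theta_{k\bar ji\bar l},$$ and let $S_C^{(2)}(\omega)=h^{i\bar l}h^{k\bar j}\Theta_{i\bar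 jk\bar l}$ be the second Chern scalar curvature. Suppose that $\omega$ is pluriclosed ($\partial\bar\partial\omega=0$) and balanced ($d\omega^{n-1}=0$), and that $$\Theta^{(3)}+\Theta^{(4)}=f\,\omega$$ for some real-valued $f\in C^\infty(M,\mathbb R)$. Then exactly one of the following holds: 1. $S_C^{(2)}(\omega)\equiv 0$ on $M$; 2. $\omega$ is Kähler–Einstein with non-zero scalar curvature, that is, $d\omega=0$, the Ricci form $\Theta^{(1)}$ equals $c\,\omega$ for a real constant $c$, and the scalar curvature $h^{i\bar j}h^{k\bar l}\Theta_{i\bar jk\bar l}$ is non-zero. -/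

import Mathlib

open scoped Manifold ContDiff

noncomputable section

/-- The model space `ℂⁿ`. A complex manifold of dimension `n` is a space charted on `CSpace n` with
`IsManifold 𝓘(ℂ, CSpace n) ω M` (all transition maps are complex analytic). -/
abbrev CSpace (n : ℕ) : Type := Fin n → ℂ

/-- The real-alternating complex-valued `k`-covectors on `ℂⁿ`, the fibre of `⋀ᵏ T*ℂⁿ ⊗ ℂ`. A complex
differential `k`-form is a function `CSpace n → CForm n k`. -/
abbrev CForm (n k : ℕ) : Type := (CSpace n) [⋀^Fin k]→L[ℝ] ℂ

namespace CForm

variable {n k l : ℕ}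

/-- The tensor product `(v₁, …, v_{k+l}) ↦ α(v₁, …, v_k) β(v_{k+1}, …, v_{k+l})`. -/
def tensor (α : CForm n k) (β : CForm n l) :
    ContinuousMultilinearMap ℝ (fun _ : Fin (k + l) => CSpace n) ℂ where
  toMultilinearMap :=
    (LinearMap.mul' ℝ ℂ).compMultilinearMap
      ((MultilinearMap.domCoprod α.toMultilinearMap β.toMultilinearMap).domDomCongr finSumFinEquiv)
  cont := by
    have h : Continuous fun v : Fin (k + l) → CSpace n =>
        α (fun i => v (Fin.castAdd l i)) * β (fun j => v (Fin.natAdd k j)) :=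
      (α.cont.comp (continuous_pi fun i => continuous_apply (Fin.castAdd l i))).mul
        (β.cont.comp (continuous_pi fun i => continuous_apply (Fin.natAdd k i)))
    refine h.congr fun v => ?_
    simp [MultilinearMap.domCoprod_apply]

/-- The wedge product `α ∧ β = (1 / (k! l!)) ∑ σ, sgn σ • σ (α ⊗ β)`, that is, the sum over
shuffles, so that `(dx ∧ dy)(v, w) = dx v * dy w - dx w * dy v`. -/
def wedge (α : CForm n k) (β : CForm n l) : CForm n (k + l) :=
  ((k.factorial : ℂ) * (l.factorial : ℂ))⁻¹ • ContinuousMultilinearMap.alternatization (tensor α β)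

/-- The wedge power `αᵏ = α ∧ ⋯ ∧ α` of a 2-form. -/
def wedgePow (α : CForm n 2) : (k : ℕ) → CForm n (2 * k)
  | 0 => haveI : IsEmpty (Fin (2 * 0)) := inferInstanceAs (IsEmpty (Fin 0))
    ContinuousAlternatingMap.constOfIsEmpty ℝ (CSpace n) (Fin (2 * 0)) (1 : ℂ)
  | k + 1 => wedge (wedgePow α k) α

/-- The coordinate 1-form `dzⁱ`. -/
def dz (i : Fin n) : CForm n 1 :=
  ContinuousAlternatingMap.ofSubsingleton ℝ (CSpace n) ℂ (0 : Fin 1)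
    (ContinuousLinearMap.proj (R := ℝ) (φ := fun _ : Fin n => ℂ) i)

/-- The coordinate 1-form `dz̄ⁱ`. -/
def dzbar (i : Fin n) : CForm n 1 :=
  ContinuousAlternatingMap.ofSubsingleton ℝ (CSpace n) ℂ (0 : Fin 1)
    ((Complex.conjCLE : ℂ →L[ℝ] ℂ).comp
      (ContinuousLinearMap.proj (R := ℝ) (φ := fun _ : Fin n => ℂ) i))

/-- Multiplication by `√-1` on `ℂⁿ`, as a real-linear map. -/
def mulI (n : ℕ) : CSpace n →L[ℝ] CSpace n := Complex.I • ContinuousLinearMap.id ℝ (CSpace n)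

/-- The complex-linear part `v ↦ (L v - √-1 L (√-1 v)) / 2` of a real-linear map. -/
def linPart (L : CSpace n →L[ℝ] CForm n k) : CSpace n →L[ℝ] CForm n k :=
  (1 / 2 : ℂ) • (L - Complex.I • L.comp (mulI n))

/-- The conjugate-linear part `v ↦ (L v + √-1 L (√-1 v)) / 2` of a real-linear map. -/
def antilinPart (L : CSpace n →L[ℝ] CForm n k) : CSpace n →L[ℝ] CForm n k :=
  (1 / 2 : ℂ) • (L + Complex.I • L.comp (mulI n))

/-- The Dolbeault operator `∂`: the exterior derivative with `d` on coefficients replaced by its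
complex-linear part, so `∂ (a dz^I ∧ dz̄^J) = ∑ i, (∂a/∂zⁱ) dzⁱ ∧ dz^I ∧ dz̄^J`. -/
def del (α : CSpace n → CForm n k) (z : CSpace n) : CForm n (k + 1) :=
  .alternatizeUncurryFin (linPart (fderiv ℝ α z))

/-- The Dolbeault operator `∂̄`, with
`∂̄ (a dz^I ∧ dz̄^J) = ∑ i, (∂a/∂z̄ⁱ) dz̄ⁱ ∧ dz^I ∧ dz̄^J`. -/
def delbar (α : CSpace n → CForm n k) (z : CSpace n) : CForm n (k + 1) :=
  .alternatizeUncurryFin (antilinPart (fderiv ℝ α z))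

end CForm

/-- The Wirtinger derivative `∂a/∂zⁱ = (∂a/∂xⁱ - √-1 ∂a/∂yⁱ) / 2`. -/
def wirtinger {n : ℕ} (i : Fin n) (a : CSpace n → ℂ) (z : CSpace n) : ℂ :=
  (1 / 2) * (fderiv ℝ a z (Pi.single i 1) - Complex.I * fderiv ℝ a z (Pi.single i Complex.I))

/-- The Wirtinger derivative `∂a/∂z̄ⁱ = (∂a/∂xⁱ + √-1 ∂a/∂yⁱ) / 2`. -/
def wirtingerBar {n : ℕ} (i : Fin n) (a : CSpace n → ℂ) (z : CSpace n) : ℂ :=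
  (1 / 2) * (fderiv ℝ a z (Pi.single i 1) + Complex.I * fderiv ℝ a z (Pi.single i Complex.I))

/-- The holomorphic charts of a complex manifold. -/
abbrev holCharts (n : ℕ) (M : Type*) [TopologicalSpace M] [ChartedSpace (CSpace n) M] :
    Set (OpenPartialHomeomorph M (CSpace n)) :=
  IsManifold.maximalAtlas 𝓘(ℂ, CSpace n) ω M

/-- The coordinate vector `∂/∂zⁱ` of the chart `φ` at the point with coordinates `z`, in the complex
tangent space (identified with `T^{1,0}M`). -/
def coordVec {n : ℕ} {M : Type*} [TopologicalSpace M] [ChartedSpace (CSpace n) M]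
    (φ : OpenPartialHomeomorph M (CSpace n)) (i : Fin n) (z : CSpace n) :
    TangentSpace 𝓘(ℂ, CSpace n) (φ.symm z) :=
  mfderiv 𝓘(ℂ, CSpace n) 𝓘(ℂ, CSpace n) φ.symm z (Pi.single i (1 : ℂ) : CSpace n)

/-- A smooth Hermitian metric on a complex manifold: a positive definite Hermitian form on each
complex tangent space, linear in the first and conjugate-linear in the second argument, whose
coefficients in every holomorphic chart are `C^∞` (in the real sense). -/
structure HermitianMetric (n : ℕ) (M : Type*) [TopologicalSpace M]
    [ChartedSpace (CSpace n) M] where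
  form : ∀ x : M, TangentSpace 𝓘(ℂ, CSpace n) x →ₗ[ℂ] TangentSpace 𝓘(ℂ, CSpace n) x →ₗ⋆[ℂ] ℂ
  conj_symm : ∀ (x : M) (v w : TangentSpace 𝓘(ℂ, CSpace n) x),
    (starRingEnd ℂ) (form x v w) = form x w v
  pos : ∀ (x : M) (v : TangentSpace 𝓘(ℂ, CSpace n) x), v ≠ 0 → 0 < (form x v v).re
  smooth : ∀ φ ∈ holCharts n M, ∀ i j : Fin n,
    ContDiffOn ℝ ∞ (fun z => form (φ.symm z) (coordVec φ i z) (coordVec φ j z)) φ.target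

namespace HermitianMetric

variable {n : ℕ} {M : Type*} [TopologicalSpace M] [ChartedSpace (CSpace n) M]
  (h : HermitianMetric n M) (φ : OpenPartialHomeomorph M (CSpace n))

/-- The coefficient `h_{i j̄}` of the metric in the chart `φ`. -/
def coeff (i j : Fin n) (z : CSpace n) : ℂ :=
  h.form (φ.symm z) (coordVec φ i z) (coordVec φ j z)

/-- The inverse coefficients `h^{i j̄}`, with `∑ l, h^{k l̄} h_{j l̄} = δ_{jk}`. -/
def invCoeff (i j : Fin n) (z : CSpace n) : ℂ :=
  (Matrix.of fun a b => h.coeff φ a b z)⁻¹ j i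

/-- The fundamental form `√-1 ∑ h_{i j̄} dzⁱ ∧ dz̄ʲ` in the chart `φ`. -/
def fundForm (z : CSpace n) : CForm n 2 :=
  ∑ i, ∑ j, (Complex.I * h.coeff φ i j z) • CForm.wedge (CForm.dz i) (CForm.dzbar j)

/-- The metric is Kähler: its fundamental form is closed. -/
def IsKaehler : Prop :=
  ∀ φ ∈ holCharts n M, ∀ z ∈ φ.target, extDeriv (h.fundForm φ) z = 0

/-- The metric is balanced: the `(n-1)`-st power of its fundamental form is closed. -/
def IsBalanced : Prop :=
  ∀ φ ∈ holCharts n M, ∀ z ∈ φ.target,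
    extDeriv (fun w => CForm.wedgePow (h.fundForm φ w) (n - 1)) z = 0

/-- The metric is pluriclosed: `∂∂̄` of its fundamental form vanishes. -/
def IsPluriclosed : Prop :=
  ∀ φ ∈ holCharts n M, ∀ z ∈ φ.target, CForm.del (CForm.delbar (h.fundForm φ)) z = 0

/-- The curvature of the Chern connection in the chart `φ`,
`Θ_{i j̄ k l̄} = - ∂²h_{k l̄}/∂zⁱ∂z̄ʲ + h^{p q̄} (∂h_{p l̄}/∂z̄ʲ) (∂h_{k q̄}/∂zⁱ)`. -/
def chernCurv (i j k l : Fin n) (z : CSpace n) : ℂ :=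
  -wirtinger i (wirtingerBar j (h.coeff φ k l)) z
    + ∑ p, ∑ q, h.invCoeff φ p q z * wirtingerBar j (h.coeff φ p l) z
        * wirtinger i (h.coeff φ k q) z

/-- The coefficient `h^{k l̄} Θ_{i j̄ k l̄}` of `dzⁱ ∧ dz̄ʲ` in the first Chern-Ricci form (divided
by `√-1`, as for the other Ricci forms). -/
def chernRicci1 (i j : Fin n) (z : CSpace n) : ℂ :=
  ∑ k, ∑ l, h.invCoeff φ k l z * h.chernCurv φ i j k l z

/-- The coefficient `h^{k l̄} Θ_{i l̄ k j̄}` of the third Chern-Ricci form. -/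
def chernRicci3 (i j : Fin n) (z : CSpace n) : ℂ :=
  ∑ k, ∑ l, h.invCoeff φ k l z * h.chernCurv φ i l k j z

/-- The coefficient `h^{k l̄} Θ_{k j̄ i l̄}` of the fourth Chern-Ricci form. -/
def chernRicci4 (i j : Fin n) (z : CSpace n) : ℂ :=
  ∑ k, ∑ l, h.invCoeff φ k l z * h.chernCurv φ k j i l z

/-- The first Chern scalar curvature `h^{i j̄} h^{k l̄} Θ_{i j̄ k l̄}`. -/
def chernScalar1 (z : CSpace n) : ℂ :=
  ∑ i, ∑ j, ∑ k, ∑ l, h.invCoeff φ i j z * h.invCoeff φ k l z * h.chernCurv φ i j k l z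

/-- The second Chern scalar curvature `h^{i l̄} h^{k j̄} Θ_{i j̄ k l̄}`. -/
def chernScalar2 (z : CSpace n) : ℂ :=
  ∑ i, ∑ j, ∑ k, ∑ l, h.invCoeff φ i l z * h.invCoeff φ k j z * h.chernCurv φ i j k l z

/-- The second Chern scalar curvature vanishes identically. -/
def ChernScalar2Vanishes : Prop :=
  ∀ φ ∈ holCharts n M, ∀ z ∈ φ.target, h.chernScalar2 φ z = 0

/-- The equation `Θ^(3) + Θ^(4) = f • (fundamental form)`, between `(1,1)`-forms. -/
def IsWeakSecondEinstein (f : M → ℝ) : Prop :=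
  ∀ φ ∈ holCharts n M, ∀ z ∈ φ.target, ∀ i j : Fin n,
    h.chernRicci3 φ i j z + h.chernRicci4 φ i j z = (f (φ.symm z) : ℂ) * h.coeff φ i j z

/-- The metric is Kähler–Einstein: it is Kähler, and its Ricci form is a constant real multiple of
its fundamental form. For a Kähler metric the Chern connection is the Levi-Civita connection, so the
Ricci form is the first Chern-Ricci form. -/
def IsKaehlerEinstein : Prop :=
  h.IsKaehler ∧ ∃ c : ℝ, ∀ φ ∈ holCharts n M, ∀ z ∈ φ.target, ∀ i j : Fin n,
    h.chernRicci1 φ i j z = (c : ℂ) * h.coeff φ i j z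

/-- The scalar curvature of a Kähler metric (the trace of its Ricci form, half of the Riemannian
scalar curvature) has no zero. For Kähler–Einstein metrics it is a constant. -/
def HasNonzeroScalar : Prop :=
  ∀ φ ∈ holCharts n M, ∀ z ∈ φ.target, h.chernScalar1 φ z ≠ 0

end HermitianMetric

end

/-! The balanced condition says that the torsion of the Chern connection is trace-free: `h^{k l̄}
∂_m h_{k l̄} = h^{k l̄} ∂_k h_{m l̄}`. Applying `-∂̄_j` turns the left side into `Θ^(1)` and the
right side into `Θ^(4)`. With Hermitian conjugation, the first, third and fourth Chern–Ricci forms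
therefore coincide, and the hypothesis becomes `2 Θ^(1) = f ω`.

Since `Θ^(1)` is locally `-√-1 ∂∂̄ log det h`, it is `∂`-closed, so `∂f ∧ ω + f ∂ω = 0`. In the
trace of this identity the torsion drops out and `(n - 1) ∂f = 0` remains. As `f` is real and `M` is
connected, `f` is constant. Moreover the two scalar curvatures agree and equal `n f / 2`. If `f =
0`, the second scalar curvature vanishes. If `f ≠ 0`, then `f ∂ω = 0` forces `dω = 0`, and `Θ^(1) =
(f / 2) ω` is the Einstein equation.

Most of the work lies in extracting the torsion identity from `d(ω^{n-1}) = 0`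
(`IsBalanced.torsionTrace_eq_zero`). Here `d(ω^{n-1}) = (n - 1) dω ∧ ω^{n-2}` is evaluated on tuples
built from a unitary frame (`IsSymplecticPairs.dWedge_wedgePow_apply`). The other carriers are
`chernRicci1_eq`, `chernRicci4_eq`, `wirtinger_chernRicci1_symm` and
`IsWeakSecondEinstein.wirtinger_eq_zero`. -/

noncomputable section

/-! ### Exterior algebra: wedging with 1-forms and 2-forms, and contraction with a vector. -/

namespace CForm

variable {n k m : ℕ}

open ContinuousAlternatingMap (alternatizeUncurryFin alternatizeUncurryFinCLM
  alternatizeUncurryFin_apply alternatizeUncurryFin_add alternatizeUncurryFinCLM_apply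
  alternatizeUncurryFin_alternatizeUncurryFinCLM_comp_of_symmetric curryLeft curryLeft_apply_apply
  curryLeftLI ofSubsingletonLIE)

/-- Left wedge multiplication by a 1-form, as a continuous bilinear map. -/
def oneWedge : (CSpace n →L[ℝ] ℂ) →L[ℝ] CForm n m →L[ℝ] CForm n (m + 1) :=
  (ContinuousLinearMap.compL ℝ (CForm n m) (CSpace n →L[ℝ] CForm n m) (CForm n (m + 1))
      (alternatizeUncurryFinCLM ℝ (CSpace n) ℂ)).comp
    ((ContinuousLinearMap.compL ℝ (CSpace n) ℂ (CForm n m)).comp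
      (ContinuousLinearMap.lsmul ℝ ℂ).flip).flip

theorem oneWedge_eq (θ : CSpace n →L[ℝ] ℂ) (η : CForm n m) :
    oneWedge θ η = alternatizeUncurryFin (θ.smulRight η) := rfl

theorem oneWedge_apply (θ : CSpace n →L[ℝ] ℂ) (η : CForm n m) (v : Fin (m + 1) → CSpace n) :
    oneWedge θ η v = ∑ i : Fin (m + 1), (-1 : ℤ) ^ (i : ℕ) • (θ (v i) * η (i.removeNth v)) := by
  rw [oneWedge_eq, alternatizeUncurryFin_apply]
  rfl

theorem oneWedge_smul (θ : CSpace n →L[ℝ] ℂ) (c : ℂ) (η : CForm n m) :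
    oneWedge θ (c • η) = c • oneWedge θ η := by
  ext v
  simp only [oneWedge_apply, ContinuousAlternatingMap.smul_apply, Finset.mul_sum, smul_eq_mul,
    mul_smul_comm, mul_left_comm]

/-- 1-forms anticommute. -/
theorem oneWedge_oneWedge (θ φ : CSpace n →L[ℝ] ℂ) (η : CForm n m) :
    oneWedge θ (oneWedge φ η) = -oneWedge φ (oneWedge θ η) := by
  -- `B α β` sends `(u, v)` to `α(u) β(v) η`. The iterated wedge is its double alternation, which
  -- kills the symmetric map `B θ φ + B φ θ`, as in the proof of `d² = 0`.
  let B (α β : CSpace n →L[ℝ] ℂ) : CSpace n →L[ℝ] CSpace n →L[ℝ] CForm n m :=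
    (ContinuousLinearMap.compL ℝ (CSpace n) ℂ (CForm n m)
      ((ContinuousLinearMap.lsmul ℝ ℂ).flip η)).comp
      ((ContinuousLinearMap.mul ℝ ℂ).bilinearComp α β)
  have hB (α β : CSpace n →L[ℝ] ℂ) : oneWedge α (oneWedge β η)
      = alternatizeUncurryFin (alternatizeUncurryFinCLM ℝ (CSpace n) ℂ ∘L B α β) := by
    rw [oneWedge_eq, oneWedge_eq]
    congr 1
    ext u v
    simp [B, alternatizeUncurryFin_apply, Finset.mul_sum, mul_assoc, mul_left_comm]
  rw [eq_neg_iff_add_eq_zero, hB, hB, ← alternatizeUncurryFin_add, ← ContinuousLinearMap.comp_add]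
  refine alternatizeUncurryFin_alternatizeUncurryFinCLM_comp_of_symmetric fun x y => ?_
  ext v
  simp [B]
  ring

/-- Contraction is an antiderivation. In the alternating sum the term `i = 0` feeds `p` to `θ`; in
all others `p` is the first argument of `η`, and the shifted index costs a sign. Degree 0 needs its
own version below, since a 0-form has no contraction. -/
theorem curryLeft_oneWedge (θ : CSpace n →L[ℝ] ℂ) (η : CForm n (m + 1)) (p : CSpace n) :
    (oneWedge θ η).curryLeft p = θ p • η - oneWedge θ (η.curryLeft p) := by
  ext v
  rw [curryLeft_apply_apply, oneWedge_apply, Fin.sum_univ_succ,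
    ContinuousAlternatingMap.sub_apply, oneWedge_apply,
    sub_eq_add_neg, ← Finset.sum_neg_distrib]
  congr 1
  · simp [Matrix.vecCons, Fin.removeNth_zero]
  · refine Finset.sum_congr rfl fun i _ => ?_
    have : (i.succ.removeNth (Matrix.vecCons p v) : Fin (m + 1) → CSpace n)
        = Matrix.vecCons p (i.removeNth v) := by
      funext j
      refine Fin.cases ?_ (fun j => ?_) j <;> simp [Fin.removeNth]
    rw [curryLeft_apply_apply, this]
    simp [pow_succ]

theorem curryLeft_oneWedge_zero (θ : CSpace n →L[ℝ] ℂ) (η : CForm n 0) (p : CSpace n) :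
    (oneWedge θ η).curryLeft p = θ p • η := by
  ext v
  rw [curryLeft_apply_apply, oneWedge_apply]
  rw [Subsingleton.elim v (Fin.removeNth 0 (Matrix.vecCons p v))]
  simp

theorem oneWedge_apply_eq_zero (θ : CSpace n →L[ℝ] ℂ) (η : CForm n m)
    (v : Fin (m + 1) → CSpace n) (hv : ∀ i, θ (v i) = 0) : oneWedge θ η v = 0 := by
  simp [oneWedge_apply, hv]

/-- The 1-form `β(x, ·)`. -/
def row : CForm n 2 →L[ℝ] CSpace n →L[ℝ] CSpace n →L[ℝ] ℂ :=
  (ContinuousLinearMap.compL ℝ (CSpace n) (CForm n 1) (CSpace n →L[ℝ] ℂ)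
    ((ofSubsingletonLIE (𝕜 := ℝ) (E := CSpace n) (F := ℂ) (0 : Fin 1)).symm :
      CForm n 1 →L[ℝ] CSpace n →L[ℝ] ℂ)).comp
    (curryLeftLI (𝕜 := ℝ) (E := CSpace n) (F := ℂ) (n := 1)).toContinuousLinearMap

theorem row_apply (β : CForm n 2) (x y : CSpace n) : row β x y = β ![x, y] := by
  have : (ofSubsingletonLIE (𝕜 := ℝ) (E := CSpace n) (F := ℂ) (0 : Fin 1)) (row β x)
      = β.curryLeft x := by
    simp [row]
  have h2 := congrArg (fun α : CForm n 1 => α ![y]) this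
  simpa using h2

theorem row_swap (β : CForm n 2) (x y : CSpace n) : row β x y = -row β y x := by
  rw [row_apply, row_apply]
  have h := β.map_swap ![y, x] (show (0 : Fin 2) ≠ 1 by decide)
  have hs : ![y, x] ∘ Equiv.swap (0 : Fin 2) 1 = ![x, y] := by
    funext i
    fin_cases i <;> simp
  rwa [hs] at h

/-- The coordinate 1-forms of a real basis of `ℂⁿ`. -/
def coord (i : Fin (Module.finrank ℝ (CSpace n))) : CSpace n →L[ℝ] ℂ :=
  Complex.ofRealCLM ∘L ((Module.finBasis ℝ (CSpace n)).coord i).toContinuousLinearMap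

theorem sum_coord_smul {F : Type*} [AddCommGroup F] [Module ℝ F] [Module ℂ F]
    [IsScalarTower ℝ ℂ F] (f : CSpace n →ₗ[ℝ] F) (v : CSpace n) :
    ∑ i, coord i v • f (Module.finBasis ℝ (CSpace n) i) = f v := by
  conv_rhs => rw [← (Module.finBasis ℝ (CSpace n)).sum_repr v, map_sum]
  refine Finset.sum_congr rfl fun i _ => ?_
  simp [coord, ← algebraMap_smul ℂ (M := F)]

theorem sum_coord_mul (f : CSpace n →L[ℝ] ℂ) (v : CSpace n) :
    ∑ i, coord i v * f (Module.finBasis ℝ (CSpace n) i) = f v :=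
  sum_coord_smul f.toLinearMap v

theorem sum_smul_coord (f : CSpace n →L[ℝ] ℂ) :
    ∑ i, f (Module.finBasis ℝ (CSpace n) i) • coord i = f := by
  ext v
  simp [← sum_coord_mul f v, mul_comm]

theorem alternatizeUncurryFin_eq_sum (f : CSpace n →L[ℝ] CForm n m) :
    alternatizeUncurryFin f = ∑ i, oneWedge (coord i) (f (Module.finBasis ℝ (CSpace n) i)) := by
  simp only [oneWedge_eq, ← alternatizeUncurryFinCLM_apply, ← map_sum]
  congr 1
  refine ContinuousLinearMap.ext fun u => ?_
  rw [← ContinuousLinearMap.coe_coe f, ← sum_coord_smul f.toLinearMap u]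
  simp [sum_apply]

theorem oneWedge_smul_left (c : ℂ) (θ : CSpace n →L[ℝ] ℂ) (η : CForm n m) :
    oneWedge (c • θ) η = c • oneWedge θ η := by
  ext v
  simp only [oneWedge_apply, smul_apply, ContinuousAlternatingMap.smul_apply, Finset.mul_sum,
    smul_eq_mul, mul_smul_comm, mul_assoc]

/-- Left wedge multiplication by a 2-form, as a continuous bilinear map. -/
def twoWedge : CForm n 2 →L[ℝ] CForm n m →L[ℝ] CForm n (m + 2) :=
  -- A 2-form is `β = ½ ∑ eⁱ ∧ β(bᵢ, ·)`, each pair of indices being counted twice. This reduces the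
  -- algebra of 2-forms to that of 1-forms.
  (1 / 2 : ℝ) • ∑ i, (ContinuousLinearMap.compL ℝ (CForm n m) (CForm n (m + 1)) (CForm n (m + 2))
    (oneWedge (coord i))).comp
    (oneWedge.comp (row.flip (Module.finBasis ℝ (CSpace n) i)))

theorem twoWedge_eq (β : CForm n 2) (η : CForm n m) :
    twoWedge β η = (1 / 2 : ℝ) • ∑ i,
      oneWedge (coord i) (oneWedge (row β (Module.finBasis ℝ (CSpace n) i)) η) := by
  simp [twoWedge]

theorem twoWedge_apply (β : CForm n 2) (η : CForm n m) (v : Fin (m + 2) → CSpace n) :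
    twoWedge β η v = (1 / 2 : ℝ) • ∑ i : Fin (m + 2), (-1 : ℤ) ^ (i : ℕ) •
      ∑ j : Fin (m + 1), (-1 : ℤ) ^ (j : ℕ) •
      (row β (v i) (i.removeNth v j) * η (j.removeNth (i.removeNth v))) := by
  let B : CSpace n →L[ℝ] CForm n (m + 1) := (oneWedge.flip η).comp (row β)
  have : twoWedge β η = (1 / 2 : ℝ) • alternatizeUncurryFin B := by
    rw [twoWedge_eq, alternatizeUncurryFin_eq_sum]
    rfl
  rw [this, ContinuousAlternatingMap.smul_apply, alternatizeUncurryFin_apply]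
  congr 1
  refine Finset.sum_congr rfl fun i _ => ?_
  congr 1
  exact oneWedge_apply _ _ _

theorem twoWedge_oneWedge (β : CForm n 2) (θ : CSpace n →L[ℝ] ℂ) (η : CForm n m) :
    twoWedge β (oneWedge θ η) = oneWedge θ (twoWedge β η) := by
  rw [twoWedge_eq, twoWedge_eq, map_smul, map_sum]
  congr 1
  refine Finset.sum_congr rfl fun i _ => ?_
  rw [oneWedge_oneWedge _ θ, map_neg, oneWedge_oneWedge _ θ, neg_neg]

theorem twoWedge_twoWedge (β γ : CForm n 2) (η : CForm n m) :
    twoWedge β (twoWedge γ η) = twoWedge γ (twoWedge β η) := by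
  rw [twoWedge_eq γ, twoWedge_eq γ, map_smul, map_sum]
  simp only [twoWedge_oneWedge]

theorem oneWedge_neg_left (θ : CSpace n →L[ℝ] ℂ) (η : CForm n m) :
    oneWedge (-θ) η = -oneWedge θ η := by
  rw [map_neg]; rfl

theorem curryLeft_real_smul (r : ℝ) (η : CForm n (m + 1)) (p : CSpace n) :
    (r • η).curryLeft p = r • η.curryLeft p := rfl

theorem curryLeft_sub_apply (η ξ : CForm n (m + 1)) (p : CSpace n) :
    (η - ξ).curryLeft p = η.curryLeft p - ξ.curryLeft p := rfl

theorem curryLeft_add_apply (η ξ : CForm n (m + 1)) (p : CSpace n) :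
    (η + ξ).curryLeft p = η.curryLeft p + ξ.curryLeft p := rfl

theorem curryLeft_sum {ι : Type*} (s : Finset ι) (η : ι → CForm n (m + 1)) (p : CSpace n) :
    (∑ i ∈ s, η i).curryLeft p = ∑ i ∈ s, (η i).curryLeft p := by
  ext v
  simp

theorem sum_coord_oneWedge (f : CSpace n →L[ℝ] CSpace n →L[ℝ] ℂ) (p : CSpace n) (η : CForm n m) :
    ∑ i, coord i p • oneWedge (f (Module.finBasis ℝ (CSpace n) i)) η = oneWedge (f p) η :=
  sum_coord_smul (((oneWedge (n := n) (m := m)).flip η).comp f).toLinearMap p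

theorem sum_smul_oneWedge_coord (f : CSpace n →L[ℝ] ℂ) (η : CForm n m) :
    ∑ i, f (Module.finBasis ℝ (CSpace n) i) • oneWedge (coord i) η = oneWedge f η := by
  conv_rhs => rw [← sum_smul_coord f, map_sum, sum_apply]
  simp only [oneWedge_smul_left]

theorem sum_row_oneWedge_coord (β : CForm n 2) (p : CSpace n) (η : CForm n m) :
    ∑ i, row β (Module.finBasis ℝ (CSpace n) i) p • oneWedge (coord i) η
      = -oneWedge (row β p) η := by
  rw [← oneWedge_neg_left, ← sum_smul_oneWedge_coord]
  refine Finset.sum_congr rfl fun i _ => ?_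
  rw [row_swap]
  rfl

/-- Contracting the factor `eⁱ` and contracting the factor `β(bᵢ, ·)` each contribute half of `β(p,
·) ∧ η`, the second through antisymmetry of `β`. -/
theorem curryLeft_twoWedge (β : CForm n 2) (η : CForm n (m + 1)) (p : CSpace n) :
    (twoWedge β η).curryLeft p = oneWedge (row β p) η + twoWedge β (η.curryLeft p) := by
  rw [twoWedge_eq, twoWedge_eq, curryLeft_real_smul, curryLeft_sum]
  simp only [curryLeft_oneWedge, map_sub, oneWedge_smul, Finset.sum_sub_distrib,
    sum_coord_oneWedge, sum_row_oneWedge_coord]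
  module

theorem curryLeft_twoWedge_zero (β : CForm n 2) (η : CForm n 0) (p : CSpace n) :
    (twoWedge β η).curryLeft p = oneWedge (row β p) η := by
  rw [twoWedge_eq, curryLeft_real_smul, curryLeft_sum]
  simp only [curryLeft_oneWedge, curryLeft_oneWedge_zero, oneWedge_smul, Finset.sum_sub_distrib,
    sum_coord_oneWedge, sum_row_oneWedge_coord]
  module

end CForm

/-! ### Comparison with the wedge product defined by alternatization; powers of a 2-form. -/

namespace CForm

variable {n k m : ℕ}

open ContinuousAlternatingMap (alternatizeUncurryFin alternatizeUncurryFinCLM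
  curryLeft curryLeft_apply_apply)

/-- A permutation of `Fin (m + 1)` is a choice of the image of `0` and a permutation of the rest. -/
def permCons (p : Fin (m + 1)) (e : Equiv.Perm (Fin m)) : Equiv.Perm (Fin (m + 1)) :=
  p.cycleRange.symm * Equiv.Perm.decomposeFin.symm (0, e)

theorem permCons_zero (p : Fin (m + 1)) (e : Equiv.Perm (Fin m)) : permCons p e 0 = p := by
  simp [permCons]

theorem permCons_succ (p : Fin (m + 1)) (e : Equiv.Perm (Fin m)) (i : Fin m) :
    permCons p e i.succ = p.succAbove (e i) := by
  simp [permCons]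

theorem sign_permCons (p : Fin (m + 1)) (e : Equiv.Perm (Fin m)) :
    Equiv.Perm.sign (permCons p e) = (-1) ^ (p : ℕ) * Equiv.Perm.sign e := by
  simp [permCons, Fin.sign_cycleRange]

theorem permCons_bijective :
    Function.Bijective fun x : Fin (m + 1) × Equiv.Perm (Fin m) => permCons x.1 x.2 := by
  rw [Fintype.bijective_iff_injective_and_card]
  refine ⟨?_, by simp [Fintype.card_perm, Nat.factorial_succ]⟩
  rintro ⟨p, e⟩ ⟨q, f⟩ h
  have h : permCons p e = permCons q f := h
  obtain rfl : p = q := by rw [← permCons_zero p e, h, permCons_zero]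
  congr
  ext i
  have := congrArg (fun g : Equiv.Perm (Fin (m + 1)) => g i.succ) h
  simp only [permCons_succ] at this
  rw [Fin.succAbove_right_injective this]

/-- Laplace expansion along the first argument; using it twice turns a sum over permutations into
the double sum of `twoWedge_apply`. -/
theorem sum_perm_sign_smul (F : (Fin (m + 1) → CSpace n) → ℂ) (v : Fin (m + 1) → CSpace n) :
    ∑ σ : Equiv.Perm (Fin (m + 1)), (Equiv.Perm.sign σ : ℤ) • F (v ∘ σ) =
      ∑ p : Fin (m + 1), (-1 : ℤ) ^ (p : ℕ) • ∑ e : Equiv.Perm (Fin m),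
        (Equiv.Perm.sign e : ℤ) • F (Matrix.vecCons (v p) (p.removeNth v ∘ e)) := by
  rw [← (permCons_bijective (m := m)).sum_comp, Fintype.sum_prod_type]
  refine Finset.sum_congr rfl fun p _ => ?_
  rw [Finset.smul_sum]
  refine Finset.sum_congr rfl fun e _ => ?_
  have : v ∘ permCons p e = Matrix.vecCons (v p) (p.removeNth v ∘ e) := by
    funext i
    refine Fin.cases ?_ (fun i => ?_) i
    · simp [permCons_zero]
    · simp [permCons_succ, Fin.removeNth]
  simp only [this, sign_permCons, smul_smul]
  push_cast
  rfl

theorem tensor_apply {l : ℕ} (α : CForm n k) (β : CForm n l) (v : Fin (k + l) → CSpace n) :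
    tensor α β v = α (fun i => v (Fin.castAdd l i)) * β (fun j => v (Fin.natAdd k j)) := by
  change (LinearMap.mul' ℝ ℂ).compMultilinearMap
    ((MultilinearMap.domCoprod α.toMultilinearMap β.toMultilinearMap).domDomCongr
      finSumFinEquiv) v = _
  simp [MultilinearMap.domCoprod_apply]

theorem finRotate_finRotate_castAdd (i : Fin m) :
    finRotate (m + 2) (finRotate (m + 2) (Fin.castAdd 2 i)) = i.succ.succ := by
  have h1 : finRotate (m + 2) (Fin.castAdd 2 i) = (Fin.castSucc i).succ := by
    rw [show Fin.castAdd 2 i = i.castSucc.castSucc from rfl, finRotate_apply, Fin.coeSucc_eq_succ]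
  rw [h1, show i.castSucc.succ = i.succ.castSucc from rfl, finRotate_apply,
    Fin.coeSucc_eq_succ]

theorem finRotate_finRotate_natAdd (j : Fin 2) :
    finRotate (m + 2) (finRotate (m + 2) (Fin.natAdd m j)) = ![0, 1] j := by
  have hl : (Fin.natAdd m (1 : Fin 2)) = Fin.last (m + 1) := rfl
  fin_cases j
  · have : finRotate (m + 2) (Fin.natAdd m (0 : Fin 2)) = Fin.last (m + 1) := by
      rw [show Fin.natAdd m (0 : Fin 2) = (Fin.last m).castSucc from rfl, finRotate_apply,
        Fin.coeSucc_eq_succ, Fin.succ_last]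
    simp [this]
  · simp [hl]

/-- Wedging with a 2-form expands over the pairs of arguments that the 2-form receives. -/
theorem wedge_eq_twoWedge (η : CForm n m) (β : CForm n 2) : wedge η β = twoWedge β η := by
  ext v
  rw [wedge, ContinuousAlternatingMap.smul_apply, twoWedge_apply]
  have halt : ContinuousMultilinearMap.alternatization (tensor η β) v
      = ∑ σ : Equiv.Perm (Fin (m + 2)), (Equiv.Perm.sign σ : ℤ) •
        ((fun w : Fin (m + 2) → CSpace n =>
          β ![w 0, w 1] * η (fun i => w i.succ.succ)) (v ∘ σ)) := by
    rw [ContinuousMultilinearMap.alternatization_apply_apply]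
    -- The tensor product feeds its last two slots to `β`, while the expansion peels off the first
    -- two. `ρ` carries the former to the latter and, being a square, is even.
    let ρ : Equiv.Perm (Fin (m + 2)) := finRotate (m + 2) * finRotate (m + 2)
    rw [← Equiv.sum_comp (Equiv.mulRight ρ)]
    refine Finset.sum_congr rfl fun σ _ => ?_
    have hs : Equiv.Perm.sign (Equiv.mulRight ρ σ) = Equiv.Perm.sign σ := by
      rw [Equiv.coe_mulRight, Equiv.Perm.sign_mul, Equiv.Perm.sign_mul, Int.units_mul_self, mul_one]
    rw [hs, tensor_apply, mul_comm]
    have h1 : (fun j => (v ∘ Equiv.mulRight ρ σ) (Fin.natAdd m j))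
        = ![(v ∘ σ) 0, (v ∘ σ) 1] := by
      funext j
      simp only [Equiv.coe_mulRight, Function.comp_apply, Equiv.Perm.coe_mul, ρ,
        finRotate_finRotate_natAdd]
      fin_cases j <;> rfl
    have h2 : (fun i => (v ∘ Equiv.mulRight ρ σ) (Fin.castAdd 2 i))
        = fun i => (v ∘ σ) i.succ.succ := by
      funext j
      simp only [Equiv.coe_mulRight, Function.comp_apply, Equiv.Perm.coe_mul, ρ,
        finRotate_finRotate_castAdd]
    rw [h1, h2]
    rfl
  have hη (w : Fin m → CSpace n) (c : ℂ) :
      ∑ e : Equiv.Perm (Fin m), (Equiv.Perm.sign e : ℤ) • (c * η (w ∘ e))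
        = (m.factorial : ℂ) * (c * η w) := by
    have (e : Equiv.Perm (Fin m)) : (Equiv.Perm.sign e : ℤ) • (c * η (w ∘ e)) = c * η w := by
      have h := η.toAlternatingMap.map_perm w e
      have h : η (w ∘ e) = (Equiv.Perm.sign e) • η w := h
      rw [h, Units.smul_def, mul_smul_comm, smul_smul, ← Units.val_mul]
      simp
    simp [this, Fintype.card_perm]
  have hinner (p : Fin (m + 2)) : ∑ e : Equiv.Perm (Fin (m + 1)), (Equiv.Perm.sign e : ℤ) •
      ((fun w : Fin (m + 2) → CSpace n => β ![w 0, w 1] * η (fun i => w i.succ.succ))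
        (Matrix.vecCons (v p) (p.removeNth v ∘ e)))
      = (m.factorial : ℂ) * ∑ j : Fin (m + 1), (-1 : ℤ) ^ (j : ℕ) •
        (row β (v p) (p.removeNth v j) * η (j.removeNth (p.removeNth v))) := by
    have := sum_perm_sign_smul (fun w : Fin (m + 1) → CSpace n =>
      row β (v p) (w 0) * η (fun i => w i.succ)) (p.removeNth v)
    simp only [row_apply] at this ⊢
    refine this.trans ?_
    rw [Finset.mul_sum]
    refine Finset.sum_congr rfl fun j _ => ?_
    rw [mul_smul_comm, ← hη]
    rfl
  have hsum := sum_perm_sign_smul (m := m + 1) (fun w : Fin (m + 2) → CSpace n =>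
    β ![w 0, w 1] * η (fun i => w i.succ.succ)) v
  have htot : ContinuousMultilinearMap.alternatization (tensor η β) v
      = (m.factorial : ℂ) * ∑ i : Fin (m + 2), (-1 : ℤ) ^ (i : ℕ) •
        ∑ j : Fin (m + 1), (-1 : ℤ) ^ (j : ℕ) •
          (row β (v i) (i.removeNth v j) * η (j.removeNth (i.removeNth v))) := by
    refine halt.trans (hsum.trans ?_)
    rw [Finset.mul_sum]
    refine Finset.sum_congr rfl fun p _ => ?_
    rw [mul_smul_comm]
    exact congrArg _ (hinner p)
  have hm : (m.factorial : ℂ) ≠ 0 := by exact_mod_cast m.factorial_ne_zero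
  -- The normalization `1 / (m! 2!)` meets the `m!` orderings of the arguments of `η`, leaving the
  -- `1 / 2` of `twoWedge`.
  rw [htot, smul_eq_mul, ← mul_assoc, Complex.real_smul]
  congr 1
  field_simp
  simp

theorem wedgePow_succ (β : CForm n 2) (k : ℕ) :
    wedgePow β (k + 1) = twoWedge β (wedgePow β k) :=
  wedge_eq_twoWedge _ _

/-- Contraction is a derivation over factors of even degree, and 1-forms commute past `β`, so the `k
+ 1` factors contribute equally. -/
theorem curryLeft_wedgePow_succ (β : CForm n 2) (p : CSpace n) (k : ℕ) :
    curryLeft (n := 2 * k + 1) (wedgePow β (k + 1)) p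
      = (k + 1 : ℝ) • oneWedge (row β p) (wedgePow β k) := by
  induction k with
  | zero =>
    rw [wedgePow_succ]
    refine (curryLeft_twoWedge_zero β (wedgePow β 0) p).trans ?_
    simp
  | succ k ih =>
    rw [wedgePow_succ]
    refine (curryLeft_twoWedge β (m := 2 * k + 1) (wedgePow β (k + 1)) p).trans ?_
    rw [ih, map_smul, twoWedge_oneWedge, ← wedgePow_succ]
    push_cast
    module

end CForm

/-! ### The derivative of a power of a 2-form and its value on symplectic tuples. -/

namespace CForm

variable {n k m : ℕ}

open ContinuousAlternatingMap (alternatizeUncurryFin alternatizeUncurryFinCLM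
  curryLeft curryLeft_apply_apply)

/-- The operator `η ↦ dω ∧ η`, for a 2-form `ω` with derivative `D`. -/
def dWedge (D : CSpace n →L[ℝ] CForm n 2) (η : CForm n m) : CForm n (m + 3) :=
  ∑ i, oneWedge (coord i) (twoWedge (D (Module.finBasis ℝ (CSpace n) i)) η)

/-- The operator `η ↦ (p ⌟ dω) ∧ η`, for a 2-form `ω` with derivative `D`. -/
def dWedgeContract (D : CSpace n →L[ℝ] CForm n 2) (p : CSpace n) (η : CForm n m) :
    CForm n (m + 2) :=
  twoWedge (D p) η
    - ∑ i, oneWedge (coord i) (oneWedge (row (D (Module.finBasis ℝ (CSpace n) i)) p) η)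

/-- The 1-form `dω(p, q, ·)`, for a 2-form `ω` with derivative `D`. -/
def dRow (D : CSpace n →L[ℝ] CForm n 2) (p q : CSpace n) : CSpace n →L[ℝ] ℂ :=
  row (D p) q - row (D q) p + ((row.comp D).flip p).flip q

theorem dRow_apply (D : CSpace n →L[ℝ] CForm n 2) (p q v : CSpace n) :
    dRow D p q v = row (D p) q v - row (D q) p v + row (D v) p q := rfl

variable (D : CSpace n →L[ℝ] CForm n 2) (p q : CSpace n)

theorem dWedge_smul (c : ℝ) (η : CForm n m) : dWedge D (c • η) = c • dWedge D η := by
  simp only [dWedge, map_smul, Finset.smul_sum]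

theorem dWedgeContract_smul (c : ℝ) (η : CForm n m) :
    dWedgeContract D p (c • η) = c • dWedgeContract D p η := by
  simp only [dWedgeContract, map_smul, Finset.smul_sum, smul_sub]

theorem dWedge_oneWedge (θ : CSpace n →L[ℝ] ℂ) (η : CForm n m) :
    dWedge D (oneWedge θ η) = -oneWedge θ (dWedge D η) := by
  simp only [dWedge, twoWedge_oneWedge, map_sum, ← Finset.sum_neg_distrib]
  exact Finset.sum_congr rfl fun i _ => oneWedge_oneWedge _ _ _

theorem dWedge_twoWedge (β : CForm n 2) (η : CForm n m) :
    dWedge D (twoWedge β η) = twoWedge β (dWedge D η) := by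
  simp only [dWedge, map_sum, twoWedge_oneWedge]
  exact Finset.sum_congr rfl fun i _ => by rw [twoWedge_twoWedge]

theorem dWedgeContract_oneWedge (θ : CSpace n →L[ℝ] ℂ) (η : CForm n m) :
    dWedgeContract D p (oneWedge θ η) = oneWedge θ (dWedgeContract D p η) := by
  simp only [dWedgeContract, twoWedge_oneWedge, map_sub, map_sum]
  congr 1
  refine Finset.sum_congr rfl fun i _ => ?_
  rw [oneWedge_oneWedge _ θ, map_neg, oneWedge_oneWedge _ θ, neg_neg]

theorem sum_coord_twoWedge (η : CForm n m) :
    ∑ i, coord i p • twoWedge (D (Module.finBasis ℝ (CSpace n) i)) η = twoWedge (D p) η :=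
  sum_coord_smul (((twoWedge (n := n) (m := m)).flip η).comp D).toLinearMap p

theorem sum_row_oneWedge_coord' (η : CForm n m) :
    ∑ i, row (D (Module.finBasis ℝ (CSpace n) i)) p q • oneWedge (coord i) η
      = oneWedge (((row.comp D).flip p).flip q) η :=
  sum_smul_oneWedge_coord (((row.comp D).flip p).flip q) η

theorem sum_coord_row_oneWedge (η : CForm n m) :
    ∑ i, coord i q • oneWedge (row (D (Module.finBasis ℝ (CSpace n) i)) p) η
      = oneWedge (row (D q) p) η :=
  sum_coord_oneWedge ((row.comp D).flip p) q η

/-- The minus sign reflects that `dω` has odd degree. -/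
theorem curryLeft_dWedge (η : CForm n (m + 1)) :
    (dWedge D η).curryLeft p = dWedgeContract D p η - dWedge D (η.curryLeft p) := by
  rw [dWedge, curryLeft_sum]
  simp only [curryLeft_oneWedge, curryLeft_twoWedge, map_add, Finset.sum_sub_distrib,
    Finset.sum_add_distrib, sum_coord_twoWedge, dWedgeContract, dWedge]
  abel

theorem curryLeft_dWedge_zero (η : CForm n 0) :
    (dWedge D η).curryLeft p = dWedgeContract D p η := by
  rw [dWedge, curryLeft_sum]
  simp only [curryLeft_oneWedge, curryLeft_twoWedge_zero, Finset.sum_sub_distrib,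
    sum_coord_twoWedge, dWedgeContract]

theorem curryLeft_dWedgeContract (η : CForm n (m + 1)) :
    (dWedgeContract D p η).curryLeft q
      = oneWedge (dRow D p q) η + dWedgeContract D p (η.curryLeft q) := by
  rw [dWedgeContract, curryLeft_sub_apply, curryLeft_sum]
  simp only [curryLeft_oneWedge, curryLeft_twoWedge, map_sub, Finset.sum_sub_distrib,
    oneWedge_smul, sum_coord_row_oneWedge, sum_row_oneWedge_coord', dWedgeContract, dRow,
    map_add, add_apply, sub_apply]
  abel

theorem curryLeft_dWedgeContract_zero (η : CForm n 0) :
    (dWedgeContract D p η).curryLeft q = oneWedge (dRow D p q) η := by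
  rw [dWedgeContract, curryLeft_sub_apply, curryLeft_sum]
  simp only [curryLeft_oneWedge, curryLeft_oneWedge_zero, curryLeft_twoWedge_zero, map_sub,
    Finset.sum_sub_distrib, oneWedge_smul, sum_coord_row_oneWedge, sum_row_oneWedge_coord', dRow,
    map_add, add_apply, sub_apply]
  abel

theorem differentiableAt_wedgePow {α : CSpace n → CForm n 2} {z : CSpace n}
    (hα : DifferentiableAt ℝ α z) (k : ℕ) :
    DifferentiableAt ℝ (fun w => wedgePow (α w) k) z := by
  induction k with
  | zero => exact differentiableAt_const _
  | succ k ih =>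
    simp only [wedgePow_succ]
    exact (twoWedge.hasFDerivAt_of_bilinear hα.hasFDerivAt ih.hasFDerivAt).differentiableAt

theorem fderiv_wedgePow_succ {α : CSpace n → CForm n 2} {z : CSpace n}
    (hα : DifferentiableAt ℝ α z) (k : ℕ) (v : CSpace n) :
    fderiv ℝ (fun w => wedgePow (α w) (k + 1)) z v
      = twoWedge (α z) (fderiv ℝ (fun w => wedgePow (α w) k) z v)
        + twoWedge (fderiv ℝ α z v) (wedgePow (α z) k) := by
  simp only [wedgePow_succ]
  have := twoWedge.hasFDerivAt_of_bilinear hα.hasFDerivAt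
    (differentiableAt_wedgePow hα k).hasFDerivAt
  exact (DFunLike.congr_fun this.fderiv v).trans rfl

/-- The Leibniz rule: even-degree factors commute, so all `k + 1` terms equal `dα ∧ αᵏ`. -/
theorem extDeriv_wedgePow {α : CSpace n → CForm n 2} {z : CSpace n}
    (hα : DifferentiableAt ℝ α z) (k : ℕ) :
    extDeriv (fun w => wedgePow (α w) (k + 1)) z
      = (k + 1 : ℝ) • dWedge (fderiv ℝ α z) (wedgePow (α z) k) := by
  induction k with
  | zero =>
    rw [extDeriv, alternatizeUncurryFin_eq_sum]
    simp only [fderiv_wedgePow_succ hα]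
    have h0 : fderiv ℝ (fun w => wedgePow (α w) 0) z = 0 := fderiv_const_apply _
    simp [h0, dWedge]
  | succ k ih =>
    rw [extDeriv, alternatizeUncurryFin_eq_sum] at ih ⊢
    simp only [fderiv_wedgePow_succ hα (k + 1), map_add, Finset.sum_add_distrib,
      ← twoWedge_oneWedge (α z)]
    rw [← map_sum, ih, map_smul]
    refine (congrArg₂ (fun s t => ((k : ℝ) + 1) • s + t)
      (dWedge_twoWedge (fderiv ℝ α z) (α z) (wedgePow (α z) k)).symm rfl).trans ?_
    rw [← wedgePow_succ]
    change ((k : ℝ) + 1) • dWedge (fderiv ℝ α z) (wedgePow (α z) (k + 1))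
      + dWedge (fderiv ℝ α z) (wedgePow (α z) (k + 1)) = _
    push_cast
    module

/-- The tuple `(p₁, q₁, …, p_k, q_k, v)`. -/
def pairTuple (v : CSpace n) : {k : ℕ} → (Fin k → CSpace n × CSpace n) → Fin (2 * k + 1) → CSpace n
  | 0, _ => ![v]
  | k + 1, P => Matrix.vecCons (P 0).1 (Matrix.vecCons (P 0).2 (pairTuple (k := k) v (Fin.tail P)) :
      Fin (2 * k + 2) → CSpace n)

theorem map_pairTuple_eq_zero (θ : CSpace n →L[ℝ] ℂ) {v : CSpace n}
    (P : Fin k → CSpace n × CSpace n) (hv : θ v = 0) (h1 : ∀ a, θ (P a).1 = 0)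
    (h2 : ∀ a, θ (P a).2 = 0) (i : Fin (2 * k + 1)) : θ (pairTuple v P i) = 0 := by
  induction k with
  | zero =>
    obtain rfl : i = 0 := Subsingleton.elim (α := Fin 1) _ _
    exact hv
  | succ k ih =>
    refine Fin.cases (n := 2 * k + 2) (h1 0) (fun i => ?_) i
    refine Fin.cases (n := 2 * k + 1) (h2 0) (fun i => ?_) i
    exact ih (Fin.tail P) (fun a => h1 a.succ) (fun a => h2 a.succ) i

/-- The pairs in `P` are mutually orthogonal for `β`, and orthogonal to `v`, and `β = c` on each
pair. -/
structure IsSymplecticPairs (β : CForm n 2) (c : ℂ) (v : CSpace n)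
    (P : Fin k → CSpace n × CSpace n) : Prop where
  pair : ∀ a, row β (P a).1 (P a).2 = c
  fst_v : ∀ a, row β (P a).1 v = 0
  snd_v : ∀ a, row β (P a).2 v = 0
  fst_fst : ∀ a b, a ≠ b → row β (P a).1 (P b).1 = 0
  fst_snd : ∀ a b, a ≠ b → row β (P a).1 (P b).2 = 0
  snd_fst : ∀ a b, a ≠ b → row β (P a).2 (P b).1 = 0
  snd_snd : ∀ a b, a ≠ b → row β (P a).2 (P b).2 = 0

namespace IsSymplecticPairs

variable {β : CForm n 2} {c : ℂ} {v : CSpace n}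

theorem tail {P : Fin (k + 1) → CSpace n × CSpace n} (h : IsSymplecticPairs β c v P) :
    IsSymplecticPairs β c v (Fin.tail P) where
  pair a := h.pair a.succ
  fst_v a := h.fst_v a.succ
  snd_v a := h.snd_v a.succ
  fst_fst a b hab := h.fst_fst _ _ (by simpa using hab)
  fst_snd a b hab := h.fst_snd _ _ (by simpa using hab)
  snd_fst a b hab := h.snd_fst _ _ (by simpa using hab)
  snd_snd a b hab := h.snd_snd _ _ (by simpa using hab)

/-- By orthogonality `β(p₁, ·)` annihilates every remaining vector of the tuple. This and its
companion for `q₁` remove the mixed terms when a pair is peeled off. -/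
theorem oneWedge_fst_apply {P : Fin (k + 1) → CSpace n × CSpace n}
    (h : IsSymplecticPairs β c v P) (η : CForm n (2 * k)) :
    oneWedge (row β (P 0).1) η (pairTuple v (Fin.tail P)) = 0 :=
  oneWedge_apply_eq_zero _ _ _ (map_pairTuple_eq_zero _ _ (h.fst_v 0)
    (fun a => h.fst_fst _ _ (Fin.succ_ne_zero a).symm)
    (fun a => h.fst_snd _ _ (Fin.succ_ne_zero a).symm))

theorem oneWedge_snd_apply {P : Fin (k + 1) → CSpace n × CSpace n}
    (h : IsSymplecticPairs β c v P) (η : CForm n (2 * k)) :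
    oneWedge (row β (P 0).2) η (pairTuple v (Fin.tail P)) = 0 :=
  oneWedge_apply_eq_zero _ _ _ (map_pairTuple_eq_zero _ _ (h.snd_v 0)
    (fun a => h.snd_fst _ _ (Fin.succ_ne_zero a).symm)
    (fun a => h.snd_snd _ _ (Fin.succ_ne_zero a).symm))

/-- Peel off one pair at a time. The only surviving term puts both members into the same factor `β`,
giving `c`, and there are `k + 1` factors to choose from. -/
theorem oneWedge_wedgePow_apply {P : Fin k → CSpace n × CSpace n}
    (h : IsSymplecticPairs β c v P) (θ : CSpace n →L[ℝ] ℂ) :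
    oneWedge θ (wedgePow β k) (pairTuple v P) = k.factorial * c ^ k * θ v := by
  induction k with
  | zero =>
    rw [oneWedge_apply]
    simp [pairTuple, wedgePow]
  | succ k ih =>
    have h1 : curryLeft (n := 2 * k + 2) (oneWedge θ (wedgePow β (k + 1))) (P 0).1
        = θ (P 0).1 • wedgePow β (k + 1)
          + (k + 1 : ℝ) • oneWedge (row β (P 0).1) (oneWedge θ (wedgePow β k)) := by
      refine (curryLeft_oneWedge (m := 2 * k + 1) θ (wedgePow β (k + 1)) (P 0).1).trans ?_
      rw [curryLeft_wedgePow_succ, map_smul, oneWedge_oneWedge]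
      module
    have h2 : curryLeft (n := 2 * k + 1) (curryLeft (n := 2 * k + 2)
        (oneWedge θ (wedgePow β (k + 1))) (P 0).1) (P 0).2
        = θ (P 0).1 • (k + 1 : ℝ) • oneWedge (row β (P 0).2) (wedgePow β k)
          + (k + 1 : ℝ) • (c • oneWedge θ (wedgePow β k)
            - oneWedge (row β (P 0).1) (curryLeft (oneWedge θ (wedgePow β k)) (P 0).2)) := by
      rw [h1, ← h.pair 0, ← curryLeft_wedgePow_succ, ← curryLeft_oneWedge]
      rfl
    refine (curryLeft_apply_apply (n := 2 * k + 2) (oneWedge θ (wedgePow β (k + 1))) (P 0).1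
      (Matrix.vecCons (P 0).2 (pairTuple v (Fin.tail P)))).symm.trans ?_
    refine (curryLeft_apply_apply (n := 2 * k + 1) (curryLeft (n := 2 * k + 2)
      (oneWedge θ (wedgePow β (k + 1))) (P 0).1) (P 0).2 (pairTuple v (Fin.tail P))).symm.trans ?_
    rw [h2]
    simp only [ContinuousAlternatingMap.add_apply, ContinuousAlternatingMap.sub_apply,
      ContinuousAlternatingMap.smul_apply, h.oneWedge_fst_apply, h.oneWedge_snd_apply, ih h.tail]
    simp [Nat.factorial_succ]
    ring

/-- Again a pair must enter a single factor. If that factor is `dω`, the rest is evaluated by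
`oneWedge_wedgePow_apply`; if it is a copy of `β`, induction applies. -/
theorem dWedge_wedgePow_apply {P : Fin (k + 1) → CSpace n × CSpace n}
    (h : IsSymplecticPairs β c v P) :
    dWedge D (wedgePow β k) (pairTuple v P)
      = k.factorial * c ^ k * ∑ a, dRow D (P a).1 (P a).2 v := by
  induction k with
  | zero =>
    refine (curryLeft_apply_apply (n := 2) (dWedge D (wedgePow β 0)) (P 0).1
      (Matrix.vecCons (P 0).2 (pairTuple v (Fin.tail P)))).symm.trans ?_
    refine (curryLeft_apply_apply (n := 1) (curryLeft (n := 2)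
      (dWedge D (wedgePow β 0)) (P 0).1) (P 0).2 (pairTuple v (Fin.tail P))).symm.trans ?_
    have h1 := curryLeft_dWedge_zero D (P 0).1 (wedgePow β 0)
    have h2 := curryLeft_dWedgeContract_zero D (P 0).1 (P 0).2 (wedgePow β 0)
    refine (congrArg (fun t : CForm n 2 => curryLeft t (P 0).2 (pairTuple v (Fin.tail P)))
      h1).trans ?_
    refine (congrArg (fun t : CForm n 1 => t (pairTuple v (Fin.tail P))) h2).trans ?_
    rw [h.tail.oneWedge_wedgePow_apply]
    simp
  | succ k ih =>
    have h1 : curryLeft (n := 2 * k + 4) (dWedge D (wedgePow β (k + 1))) (P 0).1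
        = dWedgeContract D (P 0).1 (wedgePow β (k + 1))
          + (k + 1 : ℝ) • oneWedge (row β (P 0).1) (dWedge D (wedgePow β k)) := by
      refine (curryLeft_dWedge (m := 2 * k + 1) D (P 0).1 (wedgePow β (k + 1))).trans ?_
      rw [curryLeft_wedgePow_succ, dWedge_smul, dWedge_oneWedge]
      module
    have h2 : curryLeft (n := 2 * k + 3) (curryLeft (n := 2 * k + 4)
        (dWedge D (wedgePow β (k + 1))) (P 0).1) (P 0).2
        = (oneWedge (dRow D (P 0).1 (P 0).2) (wedgePow β (k + 1))
          + (k + 1 : ℝ) • oneWedge (row β (P 0).2) (dWedgeContract D (P 0).1 (wedgePow β k)))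
          + (k + 1 : ℝ) • (c • dWedge D (wedgePow β k)
            - oneWedge (row β (P 0).1) (curryLeft (dWedge D (wedgePow β k)) (P 0).2)) := by
      rw [h1, ← h.pair 0, ← curryLeft_oneWedge, ← dWedgeContract_oneWedge,
        ← dWedgeContract_smul, ← curryLeft_wedgePow_succ]
      exact (curryLeft_add_apply (m := 2 * k + 3) _ _ _).trans <|
        congrArg₂ (fun s t : CForm n (2 * k + 3) => s + t)
        (curryLeft_dWedgeContract (m := 2 * k + 1) D (P 0).1 (P 0).2 (wedgePow β (k + 1))) rfl
    refine (curryLeft_apply_apply (n := 2 * k + 4) (dWedge D (wedgePow β (k + 1))) (P 0).1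
      (Matrix.vecCons (P 0).2 (pairTuple v (Fin.tail P)))).symm.trans ?_
    refine (curryLeft_apply_apply (n := 2 * k + 3) (curryLeft (n := 2 * k + 4)
      (dWedge D (wedgePow β (k + 1))) (P 0).1) (P 0).2 (pairTuple v (Fin.tail P))).symm.trans ?_
    rw [h2]
    have e1 := h.tail.oneWedge_wedgePow_apply (dRow D (P 0).1 (P 0).2)
    have e2 := ih h.tail
    have e3 := h.oneWedge_snd_apply (dWedgeContract D (P 0).1 (wedgePow β k))
    have e4 := h.oneWedge_fst_apply (curryLeft (dWedge D (wedgePow β k)) (P 0).2)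
    change (oneWedge (dRow D (P 0).1 (P 0).2) (wedgePow β (k + 1)) (pairTuple v (Fin.tail P))
      + (k + 1 : ℝ) • oneWedge (row β (P 0).2) (dWedgeContract D (P 0).1 (wedgePow β k))
        (pairTuple v (Fin.tail P)))
      + (k + 1 : ℝ) • (c • dWedge D (wedgePow β k) (pairTuple v (Fin.tail P))
            - oneWedge (row β (P 0).1) (curryLeft (dWedge D (wedgePow β k)) (P 0).2)
        (pairTuple v (Fin.tail P))) = _
    refine (congrArg₂ (fun a b : ℂ => a + b) (congrArg₂ (fun a b : ℂ => a + (k + 1 : ℝ) • b) e1 e3)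
      (congrArg₂ (fun a b : ℂ => (k + 1 : ℝ) • (c • a - b)) e2 e4)).trans ?_
    rw [Fin.sum_univ_succ (n := k + 1)]
    simp [Nat.factorial_succ, Fin.tail]
    ring

end IsSymplecticPairs

end CForm

/-! ### Wirtinger calculus. -/

section Wirtinger

variable {n : ℕ}

open Filter Topology

/-- The functional `∂/∂zⁱ` on real-linear differentials. -/
def wirtingerLM (i : Fin n) : (CSpace n →L[ℝ] ℂ) →ₗ[ℂ] ℂ where
  toFun L := (1 / 2) * (L (Pi.single i 1) - Complex.I * L (Pi.single i Complex.I))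
  map_add' L K := by simp only [add_apply]; ring
  map_smul' c L := by simp only [smul_apply, smul_eq_mul, RingHom.id_apply]; ring

/-- The functional `∂/∂z̄ⁱ` on real-linear differentials. -/
def wirtingerBarLM (i : Fin n) : (CSpace n →L[ℝ] ℂ) →ₗ[ℂ] ℂ where
  toFun L := (1 / 2) * (L (Pi.single i 1) + Complex.I * L (Pi.single i Complex.I))
  map_add' L K := by simp only [add_apply]; ring
  map_smul' c L := by simp only [smul_apply, smul_eq_mul, RingHom.id_apply]; ring

/-- Both Wirtinger derivatives are a fixed `ℂ`-linear functional `Λ` of the real differential, so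
commutation, product and sum rules can be proved once for every `Λ`. -/
theorem wirtinger_eq (i : Fin n) (a : CSpace n → ℂ) (z : CSpace n) :
    wirtinger i a z = wirtingerLM i (fderiv ℝ a z) := rfl

theorem wirtingerBar_eq (i : Fin n) (a : CSpace n → ℂ) (z : CSpace n) :
    wirtingerBar i a z = wirtingerBarLM i (fderiv ℝ a z) := rfl

theorem CSpace.sum_re_im_single (v : CSpace n) :
    ∑ m, ((v m).re • (Pi.single m 1 : CSpace n) + (v m).im • (Pi.single m Complex.I : CSpace n))
      = v := by
  funext j
  rw [Finset.sum_apply, Finset.sum_eq_single j]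
  · simp
  · intro m _ hm
    simp [Pi.single_eq_of_ne hm.symm]
  · simp

/-- `L v = ∑ (vᵐ ∂_m L + v̄ᵐ ∂̄_m L)`. -/
theorem apply_eq_sum_wirtinger (L : CSpace n →L[ℝ] ℂ) (v : CSpace n) :
    L v = ∑ m, (v m * wirtingerLM m L + (starRingEnd ℂ) (v m) * wirtingerBarLM m L) := by
  conv_lhs => rw [← CSpace.sum_re_im_single v, map_sum]
  refine Finset.sum_congr rfl fun m _ => ?_
  simp only [map_add, map_smul, wirtingerLM, wirtingerBarLM, LinearMap.coe_mk, AddHom.coe_mk,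
    Complex.real_smul]
  have h1 : v m = (v m).re + (v m).im * Complex.I := (Complex.re_add_im _).symm
  have h2 : (starRingEnd ℂ) (v m) = (v m).re - (v m).im * Complex.I := by
    apply Complex.ext <;> simp
  conv_rhs => rw [h2]
  conv_rhs => enter [1, 1]; rw [h1]
  linear_combination (((v m).im : ℂ) * L (Pi.single m Complex.I)) * Complex.I_mul_I

theorem wirtingerLM_conj (i : Fin n) (L : CSpace n →L[ℝ] ℂ) :
    wirtingerLM i ((Complex.conjCLE : ℂ →L[ℝ] ℂ) ∘L L) = (starRingEnd ℂ) (wirtingerBarLM i L) := by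
  simp [wirtingerLM, wirtingerBarLM, sub_eq_add_neg, Complex.conj_ofNat]

theorem wirtingerBarLM_conj (i : Fin n) (L : CSpace n →L[ℝ] ℂ) :
    wirtingerBarLM i ((Complex.conjCLE : ℂ →L[ℝ] ℂ) ∘L L) = (starRingEnd ℂ) (wirtingerLM i L) := by
  simp [wirtingerLM, wirtingerBarLM, sub_eq_add_neg, Complex.conj_ofNat]

theorem fderiv_conj (a : CSpace n → ℂ) (z : CSpace n) :
    fderiv ℝ (fun w => (starRingEnd ℂ) (a w)) z
      = (Complex.conjCLE : ℂ →L[ℝ] ℂ) ∘L fderiv ℝ a z :=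
  Complex.conjCLE.comp_fderiv

theorem conj_wirtinger (i : Fin n) (a : CSpace n → ℂ) (z : CSpace n) :
    (starRingEnd ℂ) (wirtinger i a z) = wirtingerBar i (fun w => (starRingEnd ℂ) (a w)) z := by
  rw [wirtingerBar_eq, fderiv_conj, wirtingerBarLM_conj, wirtinger_eq]

theorem conj_wirtingerBar (i : Fin n) (a : CSpace n → ℂ) (z : CSpace n) :
    (starRingEnd ℂ) (wirtingerBar i a z) = wirtinger i (fun w => (starRingEnd ℂ) (a w)) z := by
  rw [wirtinger_eq, fderiv_conj, wirtingerLM_conj, wirtingerBar_eq]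

theorem LinearMap.apply_eq_sum_coord (Λ : (CSpace n →L[ℝ] ℂ) →ₗ[ℂ] ℂ) (L : CSpace n →L[ℝ] ℂ) :
    Λ L = ∑ i, L (Module.finBasis ℝ (CSpace n) i) * Λ (CForm.coord i) := by
  conv_lhs => rw [← CForm.sum_smul_coord L, map_sum]
  simp

theorem ContDiffOn.linearMap_fderiv {U : Set (CSpace n)} (hU : IsOpen U) {a : CSpace n → ℂ}
    (ha : ContDiffOn ℝ ∞ a U) (Λ : (CSpace n →L[ℝ] ℂ) →ₗ[ℂ] ℂ) :
    ContDiffOn ℝ ∞ (fun w => Λ (fderiv ℝ a w)) U := by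
  have h := ha.fderiv_of_isOpen (m := ∞) hU (by simp)
  simp only [Λ.apply_eq_sum_coord (fderiv ℝ a _)]
  exact ContDiffOn.sum fun i _ => (h.clm_apply contDiffOn_const).mul contDiffOn_const

/-- Constant coefficient first order operators commute. -/
theorem linearMap_fderiv_comm {U : Set (CSpace n)} (hU : IsOpen U) {a : CSpace n → ℂ}
    (ha : ContDiffOn ℝ ∞ a U) (Λ Ξ : (CSpace n →L[ℝ] ℂ) →ₗ[ℂ] ℂ) {z : CSpace n} (hz : z ∈ U) :
    Λ (fderiv ℝ (fun w => Ξ (fderiv ℝ a w)) z) = Ξ (fderiv ℝ (fun w => Λ (fderiv ℝ a w)) z) := by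
  have haz : ContDiffAt ℝ ∞ a z := ha.contDiffAt (hU.mem_nhds hz)
  have hd : DifferentiableAt ℝ (fderiv ℝ a) z :=
    (ha.fderiv_of_isOpen (m := ∞) hU (by simp)).contDiffAt (hU.mem_nhds hz) |>.differentiableAt
      (by simp)
  have hsymm : IsSymmSndFDerivAt ℝ a z := haz.isSymmSndFDerivAt (by simpa using ENat.LEInfty.out)
  have key (Ω : (CSpace n →L[ℝ] ℂ) →ₗ[ℂ] ℂ) (v : CSpace n) :
      fderiv ℝ (fun w => Ω (fderiv ℝ a w)) z v
        = ∑ i, fderiv ℝ (fderiv ℝ a) z v (Module.finBasis ℝ (CSpace n) i) * Ω (CForm.coord i) := by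
    have : HasFDerivAt (fun w => Ω (fderiv ℝ a w)) (∑ i, Ω (CForm.coord i) •
        (fderiv ℝ (fderiv ℝ a) z).flip (Module.finBasis ℝ (CSpace n) i)) z := by
      simp only [Ω.apply_eq_sum_coord (fderiv ℝ a _)]
      refine HasFDerivAt.fun_sum fun i _ => ?_
      have h1 := hd.hasFDerivAt.clm_apply (hasFDerivAt_const (Module.finBasis ℝ (CSpace n) i) z)
      have h2 := h1.mul_const (Ω (CForm.coord i))
      simpa using h2
    rw [this.fderiv]
    simp [mul_comm]
  rw [Λ.apply_eq_sum_coord, Ξ.apply_eq_sum_coord]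
  simp only [key, Finset.sum_mul]
  rw [Finset.sum_comm]
  refine Finset.sum_congr rfl fun i _ => Finset.sum_congr rfl fun j _ => ?_
  rw [hsymm]
  ring

theorem linearMap_fderiv_mul (Λ : (CSpace n →L[ℝ] ℂ) →ₗ[ℂ] ℂ) {a b : CSpace n → ℂ} {z : CSpace n}
    (ha : DifferentiableAt ℝ a z) (hb : DifferentiableAt ℝ b z) :
    Λ (fderiv ℝ (fun w => a w * b w) z) = a z * Λ (fderiv ℝ b z) + b z * Λ (fderiv ℝ a z) := by
  rw [fderiv_fun_mul ha hb]
  simp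

theorem linearMap_fderiv_sum {ι : Type*} (s : Finset ι) (Λ : (CSpace n →L[ℝ] ℂ) →ₗ[ℂ] ℂ)
    {a : ι → CSpace n → ℂ} {z : CSpace n} (ha : ∀ i ∈ s, DifferentiableAt ℝ (a i) z) :
    Λ (fderiv ℝ (fun w => ∑ i ∈ s, a i w) z) = ∑ i ∈ s, Λ (fderiv ℝ (a i) z) := by
  rw [fderiv_fun_sum ha, map_sum]

theorem linearMap_fderiv_congr (Λ : (CSpace n →L[ℝ] ℂ) →ₗ[ℂ] ℂ) {U : Set (CSpace n)}
    (hU : IsOpen U) {a b : CSpace n → ℂ} (h : Set.EqOn a b U) {z : CSpace n} (hz : z ∈ U) :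
    Λ (fderiv ℝ a z) = Λ (fderiv ℝ b z) := by
  rw [(h.eventuallyEq_of_mem (hU.mem_nhds hz)).fderiv_eq]

/-- By Cramer's rule the entries of the inverse are quotients of determinants. -/
theorem ContDiffOn.matrix_inv_apply {U : Set (CSpace n)} {H : CSpace n → Matrix (Fin n) (Fin n) ℂ}
    (hH : ∀ i j, ContDiffOn ℝ ∞ (fun z => H z i j) U) (hdet : ∀ z ∈ U, (H z).det ≠ 0)
    (i j : Fin n) : ContDiffOn ℝ ∞ (fun z => (H z)⁻¹ i j) U := by
  have hd (K : CSpace n → Matrix (Fin n) (Fin n) ℂ)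
      (hK : ∀ i j, ContDiffOn ℝ ∞ (fun z => K z i j) U) :
      ContDiffOn ℝ ∞ (fun z => (K z).det) U := by
    simp only [Matrix.det_apply']
    exact ContDiffOn.sum fun σ _ => contDiffOn_const.mul (contDiffOn_prod fun k _ => hK _ _)
  simp only [Matrix.inv_def, Ring.inverse_eq_inv', Matrix.smul_apply, smul_eq_mul,
    Matrix.adjugate_apply]
  refine ((hd H hH).inv hdet).mul (hd _ fun k l => ?_)
  by_cases hk : k = j
  · subst hk
    simp only [Matrix.updateRow_self]
    exact contDiffOn_const
  · simp only [Matrix.updateRow_ne hk]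
    exact hH k l

end Wirtinger

/-! ### Unitary frames of a Hermitian matrix. -/

section MatrixFactor

open scoped ComplexOrder MatrixOrder Matrix.Norms.L2Operator

theorem Matrix.PosSemidef.exists_conjTranspose_mul_self {n : ℕ} {H : Matrix (Fin n) (Fin n) ℂ}
    (hH : H.PosSemidef) : ∃ C : Matrix (Fin n) (Fin n) ℂ, H = C.conjTranspose * C :=
  CStarAlgebra.nonneg_iff_eq_star_mul_self.mp hH.nonneg

/-- A positive definite Hermitian form has a unitary frame. -/
theorem exists_unitary_frame {n : ℕ} (H : Matrix (Fin n) (Fin n) ℂ) (hH : H.IsHermitian)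
    (hpos : ∀ v : Fin n → ℂ, v ≠ 0 → 0 < (∑ i, ∑ j, H i j * v i * (starRingEnd ℂ) (v j)).re) :
    H.det ≠ 0 ∧ ∃ u : Fin n → Fin n → ℂ,
      (∀ a b, ∑ i, ∑ j, H i j * u a i * (starRingEnd ℂ) (u b j) = if a = b then 1 else 0) ∧
      ∀ i j, ∑ a, u a i * (starRingEnd ℂ) (u a j) = H⁻¹ j i := by
  have hherm (i j : Fin n) : (starRingEnd ℂ) (H i j) = H j i := hH.apply j i
  have hpd : H.PosDef := by
    refine Matrix.PosDef.of_dotProduct_mulVec_pos hH fun x hx => ?_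
    -- `Matrix.PosDef` conjugates the vector paired with the first index, the metric the one paired
    -- with the second; hence the passage to `star x`.
    have hval : star x ⬝ᵥ H.mulVec x
        = ∑ i, ∑ j, H i j * (star x) i * (starRingEnd ℂ) ((star x) j) := by
      simp only [dotProduct, Matrix.mulVec, Finset.mul_sum]
      refine Finset.sum_congr rfl fun i _ => Finset.sum_congr rfl fun j _ => ?_
      simp
      ring
    rw [hval, Complex.pos_iff]
    refine ⟨hpos _ (by simpa using hx), ?_⟩
    symm
    rw [← Complex.conj_eq_iff_im]
    simp only [map_sum, map_mul, hherm, Complex.conj_conj]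
    rw [Finset.sum_comm]
    exact Finset.sum_congr rfl fun i _ => Finset.sum_congr rfl fun j _ => by ring
  have hdet : H.det ≠ 0 := hpd.det_pos.ne'
  refine ⟨hdet, ?_⟩
  obtain ⟨C, hC⟩ := hpd.posSemidef.exists_conjTranspose_mul_self
  have hCdet : IsUnit C.det := by
    rw [isUnit_iff_ne_zero]
    intro h0
    exact hdet (by rw [hC, Matrix.det_mul, h0, mul_zero])
  -- With `H = C* C`, the frame consists of the conjugated columns of `C⁻¹`: orthonormality reads
  -- `(C⁻¹)* H C⁻¹ = 1` and completeness reads `H⁻¹ = C⁻¹ (C⁻¹)*`.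
  refine ⟨fun a i => (starRingEnd ℂ) (C⁻¹ i a), fun a b => ?_, fun i j => ?_⟩
  · have h1 : (C⁻¹).conjTranspose * H * C⁻¹ = 1 := by
      rw [hC, Matrix.mul_assoc, Matrix.mul_assoc, Matrix.mul_nonsing_inv _ hCdet, Matrix.mul_one,
        ← Matrix.conjTranspose_mul, Matrix.mul_nonsing_inv _ hCdet, Matrix.conjTranspose_one]
    have h2 := congrFun (congrFun h1 a) b
    rw [Matrix.one_apply] at h2
    rw [← h2]
    simp only [Matrix.mul_apply, Matrix.conjTranspose_apply, Finset.sum_mul, Complex.conj_conj]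
    rw [Finset.sum_comm]
    exact Finset.sum_congr rfl fun i _ => Finset.sum_congr rfl fun j _ => by
      rw [mul_comm (H _ _)]; rfl
  · have h1 : H⁻¹ = C⁻¹ * (C⁻¹).conjTranspose := by
      rw [hC, Matrix.mul_inv_rev, Matrix.conjTranspose_nonsing_inv]
    rw [h1]
    simp only [Matrix.mul_apply, Matrix.conjTranspose_apply, Complex.conj_conj]
    exact Finset.sum_congr rfl fun a _ => mul_comm _ _

end MatrixFactor

/-! ### Metric coefficients in a chart, the fundamental form and its derivative. -/

namespace HermitianMetric

variable {n : ℕ} {M : Type*} [TopologicalSpace M] [ChartedSpace (CSpace n) M]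
  (h : HermitianMetric n M) {φ : OpenPartialHomeomorph M (CSpace n)}

theorem conj_coeff (i j : Fin n) (z : CSpace n) :
    (starRingEnd ℂ) (h.coeff φ i j z) = h.coeff φ j i z :=
  h.conj_symm _ _ _

theorem contDiffOn_coeff (hφ : φ ∈ holCharts n M) (i j : Fin n) :
    ContDiffOn ℝ ∞ (h.coeff φ i j) φ.target :=
  h.smooth φ hφ i j

/-- The inverse chart has injective differential, so a nonzero coordinate vector represents a
nonzero tangent vector. -/
theorem coeff_pos (hφ : φ ∈ holCharts n M) {z : CSpace n} (hz : z ∈ φ.target)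
    (v : CSpace n) (hv : v ≠ 0) :
    0 < (∑ i, ∑ j, h.coeff φ i j z * v i * (starRingEnd ℂ) (v j)).re := by
  have hd : φ.MDifferentiable 𝓘(ℂ, CSpace n) 𝓘(ℂ, CSpace n) :=
    ⟨(contMDiffOn_of_mem_maximalAtlas hφ).mdifferentiableOn (by simp),
      (contMDiffOn_symm_of_mem_maximalAtlas hφ).mdifferentiableOn (by simp)⟩
  let A := mfderiv 𝓘(ℂ, CSpace n) 𝓘(ℂ, CSpace n) φ.symm z
  have hinj : Function.Injective A := hd.symm.mfderiv_injective hz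
  have hA : A v = ∑ i, v i • coordVec φ i z := by
    have hv : v = ∑ i, v i • (Pi.single i (1 : ℂ) : CSpace n) := by
      funext j
      simp [Finset.sum_apply, Pi.single_apply]
    conv_lhs => rw [hv]
    exact (map_sum A _ _).trans (Finset.sum_congr rfl fun i _ => map_smul A _ _)
  have hne : A v ≠ 0 := fun h0 => hv (hinj (h0.trans (map_zero A).symm))
  have := h.pos _ _ hne
  rw [hA] at this
  simp only [map_sum, LinearMap.sum_apply, map_smul, LinearMap.smul_apply, LinearMap.map_smulₛₗ,
    smul_eq_mul] at this
  rw [Finset.sum_comm]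
  convert this using 3 with j
  rw [Finset.mul_sum]
  exact Finset.sum_congr rfl fun i _ => by rw [coeff]; ring

end HermitianMetric

namespace CForm

variable {n : ℕ}

theorem wedge_dz_dzbar_apply (i j : Fin n) (x y : CSpace n) :
    wedge (dz i) (dzbar j) ![x, y]
      = x i * (starRingEnd ℂ) (y j) - y i * (starRingEnd ℂ) (x j) := by
  have h := sum_perm_sign_smul (m := 1) (fun w => tensor (dz i) (dzbar j) w) ![x, y]
  have halt : ContinuousMultilinearMap.alternatization (tensor (dz i) (dzbar j)) ![x, y]
      = ∑ σ : Equiv.Perm (Fin 2), (Equiv.Perm.sign σ : ℤ) •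
        tensor (dz i) (dzbar j) (![x, y] ∘ σ) := by
    rw [ContinuousMultilinearMap.alternatization_apply_apply]
    rfl
  rw [wedge, ContinuousAlternatingMap.smul_apply]
  rw [halt]
  refine (congrArg _ h).trans ?_
  simp only [Finset.univ_unique, Finset.sum_singleton, tensor_apply]
  simp [dz, dzbar, Fin.removeNth, Fin.natAdd, sub_eq_add_neg]

end CForm

namespace HermitianMetric

open CForm

variable {n : ℕ} {M : Type*} [TopologicalSpace M] [ChartedSpace (CSpace n) M]
  (h : HermitianMetric n M) {φ : OpenPartialHomeomorph M (CSpace n)}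

theorem row_fundForm (z x y : CSpace n) :
    row (h.fundForm φ z) x y = Complex.I * ∑ i, ∑ j, h.coeff φ i j z *
      (x i * (starRingEnd ℂ) (y j) - y i * (starRingEnd ℂ) (x j)) := by
  rw [row_apply, fundForm, ContinuousAlternatingMap.sum_apply, Finset.mul_sum]
  refine Finset.sum_congr rfl fun i _ => ?_
  rw [ContinuousAlternatingMap.sum_apply, Finset.mul_sum]
  refine Finset.sum_congr rfl fun j _ => ?_
  rw [ContinuousAlternatingMap.smul_apply, wedge_dz_dzbar_apply, smul_eq_mul, mul_assoc]

variable (hφ : φ ∈ holCharts n M) {z : CSpace n} (hz : z ∈ φ.target)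

include hφ hz

theorem differentiableAt_coeff (i j : Fin n) : DifferentiableAt ℝ (h.coeff φ i j) z :=
  ((h.contDiffOn_coeff hφ i j).contDiffAt (φ.open_target.mem_nhds hz)).differentiableAt (by simp)

theorem hasFDerivAt_fundForm :
    HasFDerivAt (h.fundForm φ) (∑ i, ∑ j, (Complex.I • fderiv ℝ (h.coeff φ i j) z).smulRight
      (wedge (dz i) (dzbar j))) z := by
  unfold fundForm
  refine HasFDerivAt.fun_sum fun i _ => HasFDerivAt.fun_sum fun j _ => ?_
  exact ((h.differentiableAt_coeff hφ hz i j).hasFDerivAt.const_mul Complex.I).smul_const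
    (wedge (dz i) (dzbar j))

theorem row_fderiv_fundForm (v x y : CSpace n) :
    row (fderiv ℝ (h.fundForm φ) z v) x y = Complex.I * ∑ i, ∑ j, fderiv ℝ (h.coeff φ i j) z v *
      (x i * (starRingEnd ℂ) (y j) - y i * (starRingEnd ℂ) (x j)) := by
  rw [(h.hasFDerivAt_fundForm hφ hz).fderiv, row_apply, sum_apply,
    ContinuousAlternatingMap.sum_apply, Finset.mul_sum]
  refine Finset.sum_congr rfl fun i _ => ?_
  rw [sum_apply, ContinuousAlternatingMap.sum_apply, Finset.mul_sum]
  refine Finset.sum_congr rfl fun j _ => ?_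
  rw [ContinuousLinearMap.smulRight_apply, ContinuousAlternatingMap.smul_apply,
    wedge_dz_dzbar_apply]
  simp only [smul_apply, smul_eq_mul, mul_assoc]

end HermitianMetric

/-! ### The form `dω` in terms of the first derivatives of the metric. -/

/-- The trilinear form `∑ T_{mij} xᵐ yⁱ w̄ʲ`. -/
def triForm {n : ℕ} (T : Fin n → Fin n → Fin n → ℂ) (x y w : CSpace n) : ℂ :=
  ∑ i, ∑ j, ∑ m, T m i j * (x m * y i * (starRingEnd ℂ) (w j))

/-- The form `∑ T_{mij} x̄ᵐ yⁱ w̄ʲ`. -/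
def triFormBar {n : ℕ} (T : Fin n → Fin n → Fin n → ℂ) (x y w : CSpace n) : ℂ :=
  ∑ i, ∑ j, ∑ m, T m i j * ((starRingEnd ℂ) (x m) * y i * (starRingEnd ℂ) (w j))

section TriForm

variable {n : ℕ} (T : Fin n → Fin n → Fin n → ℂ) (x y w : CSpace n) (c : ℂ)

theorem triForm_smul_fst : triForm T (c • x) y w = c * triForm T x y w := by
  simp only [triForm, Finset.mul_sum, Pi.smul_apply, smul_eq_mul]
  exact Finset.sum_congr rfl fun i _ => Finset.sum_congr rfl fun j _ =>
    Finset.sum_congr rfl fun m _ => by ring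

theorem triForm_smul_snd : triForm T x (c • y) w = c * triForm T x y w := by
  simp only [triForm, Finset.mul_sum, Pi.smul_apply, smul_eq_mul]
  exact Finset.sum_congr rfl fun i _ => Finset.sum_congr rfl fun j _ =>
    Finset.sum_congr rfl fun m _ => by ring

theorem triForm_smul_trd : triForm T x y (c • w) = (starRingEnd ℂ) c * triForm T x y w := by
  simp only [triForm, Finset.mul_sum, Pi.smul_apply, smul_eq_mul, map_mul]
  exact Finset.sum_congr rfl fun i _ => Finset.sum_congr rfl fun j _ =>
    Finset.sum_congr rfl fun m _ => by ring

theorem triFormBar_smul_fst :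
    triFormBar T (c • x) y w = (starRingEnd ℂ) c * triFormBar T x y w := by
  simp only [triFormBar, Finset.mul_sum, Pi.smul_apply, smul_eq_mul, map_mul]
  exact Finset.sum_congr rfl fun i _ => Finset.sum_congr rfl fun j _ =>
    Finset.sum_congr rfl fun m _ => by ring

theorem triFormBar_smul_snd : triFormBar T x (c • y) w = c * triFormBar T x y w := by
  simp only [triFormBar, Finset.mul_sum, Pi.smul_apply, smul_eq_mul]
  exact Finset.sum_congr rfl fun i _ => Finset.sum_congr rfl fun j _ =>
    Finset.sum_congr rfl fun m _ => by ring

theorem triFormBar_smul_trd :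
    triFormBar T x y (c • w) = (starRingEnd ℂ) c * triFormBar T x y w := by
  simp only [triFormBar, Finset.mul_sum, Pi.smul_apply, smul_eq_mul, map_mul]
  exact Finset.sum_congr rfl fun i _ => Finset.sum_congr rfl fun j _ =>
    Finset.sum_congr rfl fun m _ => by ring

theorem triForm_swap (hT : ∀ m i j, T m i j = T i m j) : triForm T x y w = triForm T y x w := by
  simp only [triForm]
  rw [Finset.sum_comm]
  conv_rhs => rw [Finset.sum_comm]
  refine Finset.sum_congr rfl fun j _ => ?_
  rw [Finset.sum_comm]
  exact Finset.sum_congr rfl fun i _ => Finset.sum_congr rfl fun m _ => by rw [hT]; ring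

theorem triFormBar_swap (hT : ∀ m i j, T m i j = T j i m) :
    triFormBar T x y w = triFormBar T w y x := by
  simp only [triFormBar]
  refine Finset.sum_congr rfl fun i _ => ?_
  rw [Finset.sum_comm]
  exact Finset.sum_congr rfl fun j _ => Finset.sum_congr rfl fun m _ => by rw [hT]; ring

end TriForm

namespace HermitianMetric

open CForm

variable {n : ℕ} {M : Type*} [TopologicalSpace M] [ChartedSpace (CSpace n) M]
  (h : HermitianMetric n M) {φ : OpenPartialHomeomorph M (CSpace n)}
  (hφ : φ ∈ holCharts n M) {z : CSpace n} (hz : z ∈ φ.target)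

/-- The derivatives `∂h_{i j̄}/∂zᵐ`. -/
def coeffDeriv (φ : OpenPartialHomeomorph M (CSpace n)) (z : CSpace n) (m i j : Fin n) : ℂ :=
  wirtinger m (h.coeff φ i j) z

/-- The derivatives `∂h_{i j̄}/∂z̄ᵐ`. -/
def coeffDerivBar (φ : OpenPartialHomeomorph M (CSpace n)) (z : CSpace n) (m i j : Fin n) : ℂ :=
  wirtingerBar m (h.coeff φ i j) z

theorem conj_coeffDeriv (m i j : Fin n) :
    (starRingEnd ℂ) (h.coeffDeriv φ z m i j) = h.coeffDerivBar φ z m j i := by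
  rw [coeffDeriv, conj_wirtinger, coeffDerivBar]
  congr 1
  funext w
  exact h.conj_coeff i j w

include hφ hz

theorem row_fderiv_fundForm' (v x y : CSpace n) :
    row (fderiv ℝ (h.fundForm φ) z v) x y = Complex.I *
      (triForm (h.coeffDeriv φ z) v x y + triFormBar (h.coeffDerivBar φ z) v x y
        - triForm (h.coeffDeriv φ z) v y x - triFormBar (h.coeffDerivBar φ z) v y x) := by
  rw [h.row_fderiv_fundForm hφ hz]
  congr 1
  simp only [triForm, triFormBar, ← Finset.sum_add_distrib, ← Finset.sum_sub_distrib]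
  refine Finset.sum_congr rfl fun i _ => Finset.sum_congr rfl fun j _ => ?_
  rw [apply_eq_sum_wirtinger, Finset.sum_mul]
  refine Finset.sum_congr rfl fun m _ => ?_
  rw [coeffDeriv, coeffDerivBar, wirtinger_eq, wirtingerBar_eq]
  ring

/-- If `∂ω = 0` in coordinates then `dω = 0`. -/
theorem extDeriv_fundForm_eq_zero
    (hsymm : ∀ m i j, h.coeffDeriv φ z m i j = h.coeffDeriv φ z i m j) :
    extDeriv (h.fundForm φ) z = 0 := by
  -- Conjugating `∂ω = 0` gives `∂̄ω = 0`.
  have hbar (m i j : Fin n) : h.coeffDerivBar φ z m i j = h.coeffDerivBar φ z j i m := by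
    rw [← conj_coeffDeriv, ← conj_coeffDeriv, hsymm]
  ext v
  have hrow (a b c : Fin 3) (w : Fin 2 → CSpace n) (hw : w = ![v b, v c]) :
      fderiv ℝ (h.fundForm φ) z (v a) w = row (fderiv ℝ (h.fundForm φ) z (v a)) (v b) (v c) := by
    rw [row_apply, hw]
  rw [extDeriv, ContinuousAlternatingMap.alternatizeUncurryFin_apply, Fin.sum_univ_three,
    hrow 0 1 2, hrow 1 0 2, hrow 2 0 1]
  · simp only [h.row_fderiv_fundForm' hφ hz]
    rw [triForm_swap _ (v 1) (v 0) _ hsymm, triForm_swap _ (v 2) (v 0) _ hsymm,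
      triForm_swap _ (v 2) (v 1) _ hsymm, triFormBar_swap _ (v 2) (v 0) (v 1) hbar,
      triFormBar_swap _ (v 2) (v 1) (v 0) hbar, triFormBar_swap _ (v 1) (v 2) (v 0) hbar]
    simp
    ring
  all_goals
    funext i
    fin_cases i <;> rfl

/-- The first bracket is complex-linear in `v` and comes from `∂ω`; the second is conjugate-linear
and comes from `∂̄ω`. -/
theorem dRow_fundForm (u v : CSpace n) :
    dRow (fderiv ℝ (h.fundForm φ) z) u (Complex.I • u) v
      = 2 * (triForm (h.coeffDeriv φ z) v u u - triForm (h.coeffDeriv φ z) u v u)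
        + 2 * (triFormBar (h.coeffDerivBar φ z) v u u - triFormBar (h.coeffDerivBar φ z) u u v) := by
  simp only [dRow_apply, h.row_fderiv_fundForm' hφ hz, triForm_smul_fst, triForm_smul_snd,
    triForm_smul_trd, triFormBar_smul_fst, triFormBar_smul_snd, triFormBar_smul_trd,
    Complex.conj_I]
  linear_combination (-2 * (triForm (h.coeffDeriv φ z) v u u - triForm (h.coeffDeriv φ z) u v u)
    - 2 * (triFormBar (h.coeffDerivBar φ z) v u u - triFormBar (h.coeffDerivBar φ z) u u v))
    * Complex.I_mul_I

/-- The combination `L(v) - √-1 L(√-1 v)` doubles the complex-linear part of `L` and cancels the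
conjugate-linear part. -/
theorem dRow_fundForm_sub (u v : CSpace n) :
    dRow (fderiv ℝ (h.fundForm φ) z) u (Complex.I • u) v
      - Complex.I * dRow (fderiv ℝ (h.fundForm φ) z) u (Complex.I • u) (Complex.I • v)
      = 4 * (triForm (h.coeffDeriv φ z) v u u - triForm (h.coeffDeriv φ z) u v u) := by
  simp only [h.dRow_fundForm hφ hz, triForm_smul_fst, triForm_smul_snd, triFormBar_smul_fst,
    triFormBar_smul_trd, Complex.conj_I]
  linear_combination (-2 * (triForm (h.coeffDeriv φ z) v u u - triForm (h.coeffDeriv φ z) u v u)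
    + 2 * (triFormBar (h.coeffDerivBar φ z) v u u - triFormBar (h.coeffDerivBar φ z) u u v))
    * Complex.I_mul_I

end HermitianMetric

/-! ### Balanced metrics have trace-free torsion. -/

namespace HermitianMetric

open CForm

variable {n : ℕ} {M : Type*} [TopologicalSpace M] [ChartedSpace (CSpace n) M]
  (h : HermitianMetric n M) {φ : OpenPartialHomeomorph M (CSpace n)}

/-- The matrix of metric coefficients in a chart. -/
def coeffMatrix (φ : OpenPartialHomeomorph M (CSpace n)) (z : CSpace n) :
    Matrix (Fin n) (Fin n) ℂ :=
  Matrix.of fun a b => h.coeff φ a b z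

theorem coeffMatrix_isHermitian (z : CSpace n) : (h.coeffMatrix φ z).IsHermitian := by
  ext i j
  exact h.conj_coeff j i z

section

variable (hφ : φ ∈ holCharts n M) {z : CSpace n} (hz : z ∈ φ.target)

include hφ hz

theorem det_coeffMatrix_ne_zero : (h.coeffMatrix φ z).det ≠ 0 :=
  (exists_unitary_frame _ (h.coeffMatrix_isHermitian z) (h.coeff_pos hφ hz)).1

theorem exists_frame : ∃ u : Fin n → CSpace n,
    (∀ a b, ∑ i, ∑ j, h.coeff φ i j z * u a i * (starRingEnd ℂ) (u b j) = if a = b then 1 else 0) ∧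
      ∀ i j, ∑ a, u a i * (starRingEnd ℂ) (u a j) = h.invCoeff φ i j z :=
  (exists_unitary_frame _ (h.coeffMatrix_isHermitian z) (h.coeff_pos hφ hz)).2

theorem eq_zero_of_sum_invCoeff_mul {X : Fin n → ℂ}
    (hX : ∀ j, ∑ m, h.invCoeff φ m j z * X m = 0) : X = 0 := by
  have hdet := isUnit_iff_ne_zero.2 (h.det_coeffMatrix_ne_zero hφ hz)
  have h0 : (h.coeffMatrix φ z)⁻¹.mulVec X = 0 := funext hX
  calc X = (h.coeffMatrix φ z * (h.coeffMatrix φ z)⁻¹).mulVec X := by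
        rw [Matrix.mul_nonsing_inv _ hdet, Matrix.one_mulVec]
    _ = 0 := by rw [← Matrix.mulVec_mulVec, h0, Matrix.mulVec_zero]

end

theorem row_fundForm_frame {z : CSpace n} {u : Fin n → CSpace n}
    (hu : ∀ a b, ∑ i, ∑ j, h.coeff φ i j z * u a i * (starRingEnd ℂ) (u b j)
      = if a = b then 1 else 0) (s t : ℂ) (a b : Fin n) :
    row (h.fundForm φ z) (s • u a) (t • u b)
      = Complex.I * ((s * (starRingEnd ℂ) t - t * (starRingEnd ℂ) s) * if a = b then 1 else 0) := by
  rw [row_fundForm, sub_mul]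
  congr 1
  conv_rhs => enter [2]; rw [show (if a = b then (1 : ℂ) else 0) = if b = a then 1 else 0 by
    simp only [eq_comm]]
  rw [← hu a b, ← hu b a]
  simp only [Finset.mul_sum, ← Finset.sum_sub_distrib, Pi.smul_apply, smul_eq_mul, map_mul]
  exact Finset.sum_congr rfl fun i _ => Finset.sum_congr rfl fun j _ => by ring

/-- The torsion trace of a balanced metric vanishes, evaluated on a unitary frame. -/
theorem IsBalanced.sum_dRow_eq_zero {h : HermitianMetric n M} (hbal : h.IsBalanced) (hn : 2 ≤ n)
    (hφ : φ ∈ holCharts n M) {z : CSpace n} (hz : z ∈ φ.target) {u : Fin n → CSpace n}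
    (hu : ∀ a b, ∑ i, ∑ j, h.coeff φ i j z * u a i * (starRingEnd ℂ) (u b j)
      = if a = b then 1 else 0) (c : Fin n) (s : ℂ) :
    ∑ a, dRow (fderiv ℝ (h.fundForm φ) z) (u a) (Complex.I • u a) (s • u c) = 0 := by
  obtain ⟨k, rfl⟩ := Nat.exists_eq_add_of_le' hn
  -- Here `n = k + 2`, and `dω ∧ ωᵏ` takes `2k + 3` arguments: the `k + 1` pairs `(u_a, √-1 u_a)`
  -- with `a ≠ c`, and `s • u_c`, which is orthogonal to all of them. Each pair has `ω`-value 2.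
  let P : Fin (k + 1) → CSpace (k + 2) × CSpace (k + 2) := fun a =>
    (u (c.succAbove a), Complex.I • u (c.succAbove a))
  have hrow (s t : ℂ) (a b : Fin (k + 2)) := h.row_fundForm_frame hu s t a b
  have hrow1 (t : ℂ) (a b : Fin (k + 2)) := by simpa only [one_smul] using hrow 1 t a b
  have hrow2 (s : ℂ) (a b : Fin (k + 2)) := by simpa only [one_smul] using hrow s 1 a b
  have hrow3 (a b : Fin (k + 2)) := by simpa only [one_smul] using hrow 1 1 a b
  have hsp : IsSymplecticPairs (h.fundForm φ z) 2 (s • u c) P :=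
    { pair := fun a => by
        rw [hrow1]
        simp
        linear_combination (-2) * Complex.I_mul_I
      fst_v := fun a => by simp [P, hrow1]
      snd_v := fun a => by simp [P, hrow]
      fst_fst := fun a b hab => by simp [P, hrow3, hab]
      fst_snd := fun a b hab => by simp [P, hrow1, hab]
      snd_fst := fun a b hab => by simp [P, hrow2, hab]
      snd_snd := fun a b hab => by simp [P, hrow, hab] }
  have hω : DifferentiableAt ℝ (h.fundForm φ) z := (h.hasFDerivAt_fundForm hφ hz).differentiableAt
  have h0 : (k + 1 : ℝ) • dWedge (fderiv ℝ (h.fundForm φ) z) (wedgePow (h.fundForm φ z) k) = 0 :=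
    (extDeriv_wedgePow hω k).symm.trans (hbal φ hφ z hz)
  have h1 : dWedge (fderiv ℝ (h.fundForm φ) z) (wedgePow (h.fundForm φ z) k) = 0 :=
    (smul_eq_zero.1 h0).resolve_left (by positivity)
  have h2 := hsp.dWedge_wedgePow_apply (fderiv ℝ (h.fundForm φ) z)
  rw [h1] at h2
  have h3 : (k.factorial * 2 ^ k : ℂ) ≠ 0 :=
    mul_ne_zero (by exact_mod_cast k.factorial_ne_zero) (by simp)
  have h4 := (mul_eq_zero.1 h2.symm).resolve_left h3
  -- The omitted index costs nothing: `dω(u_c, √-1 u_c, s u_c) = 0`, since its terms cancel.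
  rw [Fin.sum_univ_succAbove _ c, h4, add_zero, h.dRow_fundForm hφ hz]
  simp only [triForm_smul_fst, triForm_smul_snd, triFormBar_smul_fst, triFormBar_smul_trd]
  ring

/-- The `(1,0)`-part of the frame identity, obtained from `s = 1` and `s = √-1`, is the torsion
trace `X` evaluated on `u_c`, because `∑ u_a ū_a` is the inverse metric. A covector that vanishes on
a frame is zero. -/
theorem IsBalanced.torsionTrace_eq_zero {h : HermitianMetric n M} (hbal : h.IsBalanced)
    (hn : 2 ≤ n) (hφ : φ ∈ holCharts n M) {z : CSpace n} (hz : z ∈ φ.target) (m : Fin n) :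
    ∑ k, ∑ l, h.invCoeff φ k l z * wirtinger m (h.coeff φ k l) z
      = ∑ k, ∑ l, h.invCoeff φ k l z * wirtinger k (h.coeff φ m l) z := by
  obtain ⟨u, hu, hinv⟩ := h.exists_frame hφ hz
  let T := h.coeffDeriv φ z
  let X (m : Fin n) : ℂ := ∑ k, ∑ l, h.invCoeff φ k l z * (T m k l - T k m l)
  have hS (c : Fin n) : ∑ a, (triForm T (u c) (u a) (u a) - triForm T (u a) (u c) (u a)) = 0 := by
    have h1 := hbal.sum_dRow_eq_zero hn hφ hz hu c 1
    have h2 := hbal.sum_dRow_eq_zero hn hφ hz hu c Complex.I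
    simp only [one_smul] at h1
    have h3 := congrArg₂ (fun a b : ℂ => a - Complex.I * b) h1 h2
    simp only [Finset.mul_sum, ← Finset.sum_sub_distrib, h.dRow_fundForm_sub hφ hz] at h3
    rw [← Finset.mul_sum] at h3
    simpa using h3
  have hX (c : Fin n) : ∑ m, u c m * X m = 0 := by
    rw [← hS c]
    have e1 : ∑ a, triForm T (u c) (u a) (u a)
        = ∑ m, ∑ k, ∑ l, u c m * (h.invCoeff φ k l z * T m k l) := by
      simp only [triForm, ← hinv, Finset.sum_mul, Finset.mul_sum]
      rw [Finset.sum_comm]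
      conv_rhs => rw [Finset.sum_comm]
      refine Finset.sum_congr rfl fun i _ => ?_
      rw [Finset.sum_comm]
      conv_rhs => rw [Finset.sum_comm]
      refine Finset.sum_congr rfl fun j _ => ?_
      rw [Finset.sum_comm]
      exact Finset.sum_congr rfl fun m _ => Finset.sum_congr rfl fun a _ => by ring
    have e2 : ∑ a, triForm T (u a) (u c) (u a)
        = ∑ m, ∑ k, ∑ l, u c m * (h.invCoeff φ k l z * T k m l) := by
      simp only [triForm, ← hinv, Finset.sum_mul, Finset.mul_sum]
      rw [Finset.sum_comm]
      refine Finset.sum_congr rfl fun i _ => ?_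
      rw [Finset.sum_comm]
      conv_rhs => rw [Finset.sum_comm]
      refine Finset.sum_congr rfl fun j _ => ?_
      rw [Finset.sum_comm]
      exact Finset.sum_congr rfl fun m _ => Finset.sum_congr rfl fun a _ => by ring
    rw [Finset.sum_sub_distrib, e1, e2]
    simp only [X, Finset.mul_sum, mul_sub, Finset.sum_sub_distrib]
  have hX0 : X = 0 := by
    refine h.eq_zero_of_sum_invCoeff_mul hφ hz fun j => ?_
    calc ∑ m, h.invCoeff φ m j z * X m
        = ∑ a, (starRingEnd ℂ) (u a j) * ∑ m, u a m * X m := by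
          simp only [← hinv, Finset.sum_mul, Finset.mul_sum]
          rw [Finset.sum_comm]
          exact Finset.sum_congr rfl fun m _ => Finset.sum_congr rfl fun a _ => by ring
      _ = 0 := by simp [hX]
  have := congrFun hX0 m
  simp only [X, mul_sub, Finset.sum_sub_distrib, Pi.zero_apply] at this
  exact sub_eq_zero.1 this

end HermitianMetric

/-! ### Derivatives of the inverse metric and the Chern–Ricci forms. -/

theorem ContDiffOn.differentiableAt_of_mem {n : ℕ} {a : CSpace n → ℂ} {U : Set (CSpace n)}
    (ha : ContDiffOn ℝ ∞ a U) (hU : IsOpen U) {z : CSpace n} (hz : z ∈ U) :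
    DifferentiableAt ℝ a z :=
  (ha.contDiffAt (hU.mem_nhds hz)).differentiableAt (by simp)

namespace HermitianMetric

variable {n : ℕ} {M : Type*} [TopologicalSpace M] [ChartedSpace (CSpace n) M]
  (h : HermitianMetric n M) {φ : OpenPartialHomeomorph M (CSpace n)}

theorem conj_invCoeff (i j : Fin n) (z : CSpace n) :
    (starRingEnd ℂ) (h.invCoeff φ i j z) = h.invCoeff φ j i z :=
  (h.coeffMatrix_isHermitian z).inv.apply i j

theorem chernScalar1_eq (z : CSpace n) : h.chernScalar1 φ z
    = ∑ i, ∑ j, h.invCoeff φ i j z * h.chernRicci1 φ i j z := by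
  simp only [chernScalar1, chernRicci1, Finset.mul_sum, mul_assoc]

theorem chernScalar2_eq (z : CSpace n) : h.chernScalar2 φ z
    = ∑ k, ∑ j, h.invCoeff φ k j z * h.chernRicci4 φ k j z := by
  simp only [chernScalar2, chernRicci4, Finset.mul_sum]
  calc _ = ∑ j, ∑ i, ∑ k, ∑ l, h.invCoeff φ i l z * h.invCoeff φ k j z * h.chernCurv φ i j k l z :=
        Finset.sum_comm
    _ = ∑ j, ∑ k, ∑ i, ∑ l, h.invCoeff φ i l z * h.invCoeff φ k j z * h.chernCurv φ i j k l z :=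
        Finset.sum_congr rfl fun j _ => Finset.sum_comm
    _ = ∑ k, ∑ j, ∑ i, ∑ l, h.invCoeff φ i l z * h.invCoeff φ k j z * h.chernCurv φ i j k l z :=
        Finset.sum_comm
    _ = _ := Finset.sum_congr rfl fun k _ => Finset.sum_congr rfl fun j _ =>
        Finset.sum_congr rfl fun i _ => Finset.sum_congr rfl fun l _ => by ring

section

variable (hφ : φ ∈ holCharts n M)

include hφ

theorem contDiffOn_invCoeff (i j : Fin n) : ContDiffOn ℝ ∞ (h.invCoeff φ i j) φ.target :=
  ContDiffOn.matrix_inv_apply (H := h.coeffMatrix φ) (fun k l => h.contDiffOn_coeff hφ k l)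
    (fun _ hz => h.det_coeffMatrix_ne_zero hφ hz) j i

variable {z : CSpace n} (hz : z ∈ φ.target)

include hz

theorem sum_invCoeff_mul_coeff (k j : Fin n) :
    ∑ l, h.invCoeff φ k l z * h.coeff φ j l z = if j = k then 1 else 0 := by
  have := congrFun (congrFun (Matrix.mul_nonsing_inv _
    (isUnit_iff_ne_zero.2 (h.det_coeffMatrix_ne_zero hφ hz))) j) k
  rw [Matrix.one_apply, Matrix.mul_apply] at this
  rw [← this]
  exact Finset.sum_congr rfl fun l _ => mul_comm _ _

theorem sum_invCoeff_mul_coeff' (l j : Fin n) :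
    ∑ k, h.invCoeff φ k l z * h.coeff φ k j z = if l = j then 1 else 0 := by
  have := congrFun (congrFun (Matrix.nonsing_inv_mul _
    (isUnit_iff_ne_zero.2 (h.det_coeffMatrix_ne_zero hφ hz))) l) j
  rw [Matrix.one_apply, Matrix.mul_apply] at this
  rw [← this]
  rfl

theorem sum_sum_invCoeff_mul_coeff :
    ∑ k, ∑ l, h.invCoeff φ k l z * h.coeff φ k l z = n := by
  simp [h.sum_invCoeff_mul_coeff hφ hz]

/-- The derivative of the inverse metric. -/
theorem linearMap_fderiv_invCoeff (Λ : (CSpace n →L[ℝ] ℂ) →ₗ[ℂ] ℂ) (k m : Fin n) :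
    Λ (fderiv ℝ (h.invCoeff φ k m) z) = -∑ p, ∑ q, h.invCoeff φ p m z *
      Λ (fderiv ℝ (h.coeff φ p q) z) * h.invCoeff φ k q z := by
  have hd (k l : Fin n) := (h.contDiffOn_invCoeff hφ k l).differentiableAt_of_mem φ.open_target hz
  have hc (k l : Fin n) := (h.contDiffOn_coeff hφ k l).differentiableAt_of_mem φ.open_target hz
  -- Differentiate `h^{k l̄} h_{j l̄} = δ_{jk}`; contracting with `h^{j m̄}` then isolates the
  -- derivative of the inverse.
  have key (j : Fin n) : ∑ l, (h.invCoeff φ k l z * Λ (fderiv ℝ (h.coeff φ j l) z)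
      + h.coeff φ j l z * Λ (fderiv ℝ (h.invCoeff φ k l) z)) = 0 := by
    have h1 : Λ (fderiv ℝ (fun w => ∑ l, h.invCoeff φ k l w * h.coeff φ j l w) z) = 0 := by
      rw [linearMap_fderiv_congr Λ φ.open_target
        (fun w hw => h.sum_invCoeff_mul_coeff hφ hw k j) hz, fderiv_const_apply, map_zero]
    rw [← h1, linearMap_fderiv_sum _ _ fun l _ => (hd k l).fun_mul (hc j l)]
    exact Finset.sum_congr rfl fun l _ => (linearMap_fderiv_mul Λ (hd k l) (hc j l)).symm
  have h2 : ∑ j, h.invCoeff φ j m z * ∑ l, (h.invCoeff φ k l z * Λ (fderiv ℝ (h.coeff φ j l) z)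
      + h.coeff φ j l z * Λ (fderiv ℝ (h.invCoeff φ k l) z)) = 0 := by
    simp [key]
  have h3 : ∑ j, h.invCoeff φ j m z * ∑ l, h.coeff φ j l z * Λ (fderiv ℝ (h.invCoeff φ k l) z)
      = Λ (fderiv ℝ (h.invCoeff φ k m) z) := by
    simp only [Finset.mul_sum, ← mul_assoc]
    rw [Finset.sum_comm]
    simp only [← Finset.sum_mul, h.sum_invCoeff_mul_coeff' hφ hz]
    simp
  simp only [Finset.sum_add_distrib, mul_add] at h2
  rw [h3] at h2
  rw [eq_neg_of_add_eq_zero_right h2]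
  congr 1
  refine Finset.sum_congr rfl fun p _ => ?_
  rw [Finset.mul_sum]
  exact Finset.sum_congr rfl fun q _ => by ring

/-- The derivative of a contraction with the inverse metric. -/
theorem linearMap_fderiv_contract (Λ : (CSpace n →L[ℝ] ℂ) →ₗ[ℂ] ℂ) {g : Fin n → Fin n → CSpace n → ℂ}
    (hg : ∀ k l, ContDiffOn ℝ ∞ (g k l) φ.target) :
    Λ (fderiv ℝ (fun w => ∑ k, ∑ l, h.invCoeff φ k l w * g k l w) z)
      = ∑ k, ∑ l, h.invCoeff φ k l z * (Λ (fderiv ℝ (g k l) z)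
        - ∑ p, ∑ q, h.invCoeff φ p q z * Λ (fderiv ℝ (h.coeff φ p l) z) * g k q z) := by
  have hd (k l : Fin n) := (h.contDiffOn_invCoeff hφ k l).differentiableAt_of_mem φ.open_target hz
  have hc (k l : Fin n) := (hg k l).differentiableAt_of_mem φ.open_target hz
  rw [linearMap_fderiv_sum _ _ fun k _ => .fun_sum fun l _ => (hd k l).fun_mul (hc k l)]
  simp only [mul_sub, Finset.sum_sub_distrib]
  have h1 (k : Fin n) : Λ (fderiv ℝ (fun w => ∑ l, h.invCoeff φ k l w * g k l w) z)
      = ∑ l, h.invCoeff φ k l z * Λ (fderiv ℝ (g k l) z)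
        - ∑ l, ∑ p, ∑ q, g k l z * (h.invCoeff φ p l z * Λ (fderiv ℝ (h.coeff φ p q) z)
          * h.invCoeff φ k q z) := by
    rw [linearMap_fderiv_sum _ _ fun l _ => (hd k l).fun_mul (hc k l), ← Finset.sum_sub_distrib]
    refine Finset.sum_congr rfl fun l _ => ?_
    rw [linearMap_fderiv_mul Λ (hd k l) (hc k l), h.linearMap_fderiv_invCoeff hφ hz]
    simp only [mul_neg, Finset.mul_sum, sub_eq_add_neg]
  simp only [h1, Finset.sum_sub_distrib]
  congr 1
  -- Exchanging the names `l` and `q` brings the term from the derivative of the inverse metric to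
  -- the shape of the quadratic term of the Chern curvature.
  refine Finset.sum_congr rfl fun k _ => ?_
  simp only [Finset.mul_sum]
  calc _ = ∑ l, ∑ q, ∑ p, g k l z * (h.invCoeff φ p l z * Λ (fderiv ℝ (h.coeff φ p q) z)
          * h.invCoeff φ k q z) := Finset.sum_congr rfl fun l _ => Finset.sum_comm
    _ = ∑ q, ∑ l, ∑ p, g k l z * (h.invCoeff φ p l z * Λ (fderiv ℝ (h.coeff φ p q) z)
          * h.invCoeff φ k q z) := Finset.sum_comm
    _ = _ := by
      refine Finset.sum_congr rfl fun q _ => ?_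
      rw [Finset.sum_comm]
      exact Finset.sum_congr rfl fun p _ => Finset.sum_congr rfl fun l _ => by ring

/-- The contraction is `∂_i log det h`. Differentiating the inverse metric in it produces exactly
the quadratic term of the curvature. -/
theorem chernRicci1_eq (i j : Fin n) : h.chernRicci1 φ i j z
    = -wirtingerBar j (fun w => ∑ k, ∑ l, h.invCoeff φ k l w * wirtinger i (h.coeff φ k l) w) z := by
  simp only [wirtinger_eq, wirtingerBar_eq]
  rw [h.linearMap_fderiv_contract hφ hz _
    fun k l => (h.contDiffOn_coeff hφ k l).linearMap_fderiv φ.open_target (wirtingerLM i)]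
  simp only [chernRicci1, chernCurv, ← Finset.sum_neg_distrib]
  refine Finset.sum_congr rfl fun k _ => Finset.sum_congr rfl fun l _ => ?_
  have hcomm : wirtingerLM i (fderiv ℝ (wirtingerBar j (h.coeff φ k l)) z)
      = wirtingerBarLM j (fderiv ℝ (fun w => wirtingerLM i (fderiv ℝ (h.coeff φ k l) w)) z) :=
    linearMap_fderiv_comm φ.open_target (h.contDiffOn_coeff hφ k l) _ (wirtingerBarLM j) hz
  simp only [wirtinger_eq, wirtingerBar_eq]
  rw [hcomm]
  ring

/-- The same computation with the other torsion trace, `h^{k l̄} ∂_k h_{i l̄}`, which makes this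
form comparable with the first one. -/
theorem chernRicci4_eq (i j : Fin n) : h.chernRicci4 φ i j z
    = -wirtingerBar j (fun w => ∑ k, ∑ l, h.invCoeff φ k l w * wirtinger k (h.coeff φ i l) w) z := by
  simp only [wirtinger_eq, wirtingerBar_eq]
  rw [h.linearMap_fderiv_contract hφ hz _
    fun k l => (h.contDiffOn_coeff hφ i l).linearMap_fderiv φ.open_target (wirtingerLM k)]
  simp only [chernRicci4, chernCurv, ← Finset.sum_neg_distrib]
  refine Finset.sum_congr rfl fun k _ => Finset.sum_congr rfl fun l _ => ?_
  have hcomm : wirtingerLM k (fderiv ℝ (wirtingerBar j (h.coeff φ i l)) z)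
      = wirtingerBarLM j (fderiv ℝ (fun w => wirtingerLM k (fderiv ℝ (h.coeff φ i l) w)) z) :=
    linearMap_fderiv_comm φ.open_target (h.contDiffOn_coeff hφ i l) _ (wirtingerBarLM j) hz
  simp only [wirtinger_eq, wirtingerBar_eq]
  rw [hcomm]
  ring

omit hz in
theorem contDiffOn_chernRicci1 (i j : Fin n) :
    ContDiffOn ℝ ∞ (h.chernRicci1 φ i j) φ.target := by
  refine ContDiffOn.congr ?_ fun z hz => h.chernRicci1_eq hφ hz i j
  refine (ContDiffOn.linearMap_fderiv φ.open_target ?_ (wirtingerBarLM j)).neg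
  exact ContDiffOn.sum fun k _ => ContDiffOn.sum fun l _ => (h.contDiffOn_invCoeff hφ k l).mul
    ((h.contDiffOn_coeff hφ k l).linearMap_fderiv φ.open_target (wirtingerLM i))

theorem conj_chernCurv (i j k l : Fin n) :
    (starRingEnd ℂ) (h.chernCurv φ i j k l z) = h.chernCurv φ j i l k z := by
  have e1 (j k l : Fin n) (w : CSpace n) : (starRingEnd ℂ) (wirtingerBar j (h.coeff φ k l) w)
      = wirtinger j (h.coeff φ l k) w := by
    rw [conj_wirtingerBar]
    congr 1
    exact funext fun w => h.conj_coeff k l w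
  have e2 (j k l : Fin n) (w : CSpace n) : (starRingEnd ℂ) (wirtinger j (h.coeff φ k l) w)
      = wirtingerBar j (h.coeff φ l k) w := by
    rw [conj_wirtinger]
    congr 1
    exact funext fun w => h.conj_coeff k l w
  have e3 : (starRingEnd ℂ) (wirtinger i (wirtingerBar j (h.coeff φ k l)) z)
      = wirtinger j (wirtingerBar i (h.coeff φ l k)) z := by
    rw [conj_wirtinger]
    simp only [e1]
    exact (linearMap_fderiv_comm φ.open_target (h.contDiffOn_coeff hφ l k)
      (wirtingerLM j) (wirtingerBarLM i) hz).symm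
  simp only [chernCurv, map_add, map_neg, map_sum, map_mul, e1, e2, e3, h.conj_invCoeff]
  congr 1
  rw [Finset.sum_comm]
  exact Finset.sum_congr rfl fun p _ => Finset.sum_congr rfl fun q _ => by ring

theorem conj_chernRicci1 (i j : Fin n) :
    (starRingEnd ℂ) (h.chernRicci1 φ i j z) = h.chernRicci1 φ j i z := by
  simp only [chernRicci1, map_sum, map_mul, h.conj_chernCurv hφ hz, h.conj_invCoeff]
  exact Finset.sum_comm

theorem conj_chernRicci4 (i j : Fin n) :
    (starRingEnd ℂ) (h.chernRicci4 φ i j z) = h.chernRicci3 φ j i z := by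
  simp only [chernRicci3, chernRicci4, map_sum, map_mul, h.conj_chernCurv hφ hz, h.conj_invCoeff]
  exact Finset.sum_comm

/-- The first Chern-Ricci form is `∂`-closed. -/
theorem wirtinger_chernRicci1_symm (m i j : Fin n) :
    wirtinger m (h.chernRicci1 φ i j) z = wirtinger i (h.chernRicci1 φ m j) z := by
  let A (i : Fin n) (w : CSpace n) : ℂ :=
    ∑ k, ∑ l, h.invCoeff φ k l w * wirtinger i (h.coeff φ k l) w
  have hA (i : Fin n) : ContDiffOn ℝ ∞ (A i) φ.target :=
    ContDiffOn.sum fun k _ => ContDiffOn.sum fun l _ => (h.contDiffOn_invCoeff hφ k l).mul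
      ((h.contDiffOn_coeff hφ k l).linearMap_fderiv φ.open_target (wirtingerLM i))
  -- `A` is locally `∂ log det h`, hence `∂`-closed. Concretely, second derivatives commute, and the
  -- quadratic terms match under `k ↔ p`, `l ↔ q`.
  have hsymm (w : CSpace n) (hw : w ∈ φ.target) : wirtinger m (A i) w = wirtinger i (A m) w := by
    have e (i : Fin n) (Λ : (CSpace n →L[ℝ] ℂ) →ₗ[ℂ] ℂ) := h.linearMap_fderiv_contract hφ hw Λ
      fun k l => (h.contDiffOn_coeff hφ k l).linearMap_fderiv φ.open_target (wirtingerLM i)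
    refine (e i (wirtingerLM m)).trans (Eq.trans ?_ (e m (wirtingerLM i)).symm)
    simp only [mul_sub, Finset.sum_sub_distrib, Finset.mul_sum]
    congr 1
    · refine Finset.sum_congr rfl fun k _ => Finset.sum_congr rfl fun l _ => ?_
      rw [linearMap_fderiv_comm φ.open_target (h.contDiffOn_coeff hφ k l) _ _ hw]
    · calc _ = ∑ k, ∑ p, ∑ l, ∑ q, h.invCoeff φ k l w * (h.invCoeff φ p q w *
          wirtingerLM m (fderiv ℝ (h.coeff φ p l) w) *
            wirtingerLM i (fderiv ℝ (h.coeff φ k q) w)) :=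
            Finset.sum_congr rfl fun k _ => Finset.sum_comm
        _ = ∑ p, ∑ k, ∑ l, ∑ q, h.invCoeff φ k l w * (h.invCoeff φ p q w *
          wirtingerLM m (fderiv ℝ (h.coeff φ p l) w) *
            wirtingerLM i (fderiv ℝ (h.coeff φ k q) w)) := Finset.sum_comm
        _ = ∑ p, ∑ k, ∑ q, ∑ l, h.invCoeff φ k l w * (h.invCoeff φ p q w *
          wirtingerLM m (fderiv ℝ (h.coeff φ p l) w) *
            wirtingerLM i (fderiv ℝ (h.coeff φ k q) w)) :=
            Finset.sum_congr rfl fun p _ => Finset.sum_congr rfl fun k _ => Finset.sum_comm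
        _ = ∑ p, ∑ q, ∑ k, ∑ l, h.invCoeff φ k l w * (h.invCoeff φ p q w *
          wirtingerLM m (fderiv ℝ (h.coeff φ p l) w) *
            wirtingerLM i (fderiv ℝ (h.coeff φ k q) w)) :=
            Finset.sum_congr rfl fun p _ => Finset.sum_comm
        _ = _ := Finset.sum_congr rfl fun p _ => Finset.sum_congr rfl fun q _ =>
            Finset.sum_congr rfl fun k _ => Finset.sum_congr rfl fun l _ => by ring
  have hR (m i : Fin n) : wirtinger m (h.chernRicci1 φ i j) z
      = -wirtingerBarLM j (fderiv ℝ (fun w => wirtinger m (A i) w) z) := by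
    have e1 : wirtinger m (h.chernRicci1 φ i j) z
        = wirtingerLM m (fderiv ℝ (fun w => -wirtingerBarLM j (fderiv ℝ (A i) w)) z) :=
      linearMap_fderiv_congr (wirtingerLM m) φ.open_target (fun w hw => h.chernRicci1_eq hφ hw i j) hz
    rw [e1, fderiv_fun_neg, map_neg,
      linearMap_fderiv_comm φ.open_target (hA i) (wirtingerLM m) (wirtingerBarLM j) hz]
    rfl
  rw [hR, hR, linearMap_fderiv_congr _ φ.open_target hsymm hz]

end

/-! ### Consequences of the balanced and Einstein conditions; constancy of the factor. -/

namespace IsBalanced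

variable {h} (hbal : h.IsBalanced) (hn : 2 ≤ n) (hφ : φ ∈ holCharts n M) {z : CSpace n}
  (hz : z ∈ φ.target)

include hbal hn hφ hz

/-- The two forms are `-∂̄_j` of the two sides of `torsionTrace_eq_zero`. -/
theorem chernRicci4_eq_chernRicci1 (i j : Fin n) :
    h.chernRicci4 φ i j z = h.chernRicci1 φ i j z := by
  rw [h.chernRicci4_eq hφ hz, h.chernRicci1_eq hφ hz, wirtingerBar_eq, wirtingerBar_eq,
    linearMap_fderiv_congr _ φ.open_target
      (fun w hw => (hbal.torsionTrace_eq_zero hn hφ hw i).symm) hz]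

theorem chernRicci3_eq_chernRicci1 (i j : Fin n) :
    h.chernRicci3 φ i j z = h.chernRicci1 φ i j z := by
  rw [← h.conj_chernRicci4 hφ hz, hbal.chernRicci4_eq_chernRicci1 hn hφ hz,
    h.conj_chernRicci1 hφ hz]

theorem chernScalar2_eq_chernScalar1 : h.chernScalar2 φ z = h.chernScalar1 φ z := by
  simp only [h.chernScalar2_eq, h.chernScalar1_eq, hbal.chernRicci4_eq_chernRicci1 hn hφ hz]

end IsBalanced

section WeakSecondEinstein

variable {h} {f : M → ℝ} (hE : h.IsWeakSecondEinstein f) (hbal : h.IsBalanced) (hn : 2 ≤ n)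
  (hφ : φ ∈ holCharts n M)

include hE hbal hn hφ

theorem IsWeakSecondEinstein.chernRicci1 {z : CSpace n} (hz : z ∈ φ.target) (i j : Fin n) :
    2 * h.chernRicci1 φ i j z = (f (φ.symm z) : ℂ) * h.coeff φ i j z := by
  rw [← hE φ hφ z hz i j, hbal.chernRicci3_eq_chernRicci1 hn hφ hz,
    hbal.chernRicci4_eq_chernRicci1 hn hφ hz, two_mul]

theorem IsWeakSecondEinstein.chernScalar1 {z : CSpace n} (hz : z ∈ φ.target) :
    2 * h.chernScalar1 φ z = n * (f (φ.symm z) : ℂ) := by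
  rw [h.chernScalar1_eq, ← h.sum_sum_invCoeff_mul_coeff hφ hz, Finset.mul_sum, Finset.sum_mul]
  refine Finset.sum_congr rfl fun i _ => ?_
  rw [Finset.mul_sum, Finset.sum_mul]
  refine Finset.sum_congr rfl fun j _ => ?_
  linear_combination h.invCoeff φ i j z * hE.chernRicci1 hbal hn hφ hz i j

/-- The factor is `2 / n` times the scalar curvature, which inherits smoothness from the metric. -/
theorem IsWeakSecondEinstein.contDiffOn :
    ContDiffOn ℝ ∞ (fun z => (f (φ.symm z) : ℂ)) φ.target := by
  have hn0 : (n : ℂ) ≠ 0 := by exact_mod_cast (by omega : n ≠ 0)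
  have hS : ContDiffOn ℝ ∞ (fun z => (n : ℂ)⁻¹ * (2 *
      ∑ i, ∑ j, h.invCoeff φ i j z * h.chernRicci1 φ i j z)) φ.target :=
    contDiffOn_const.mul <| contDiffOn_const.mul <| ContDiffOn.sum fun i _ => ContDiffOn.sum
      fun j _ => (h.contDiffOn_invCoeff hφ i j).mul (h.contDiffOn_chernRicci1 hφ i j)
  refine hS.congr fun z hz => ?_
  rw [← h.chernScalar1_eq, hE.chernScalar1 hbal hn hφ hz, inv_mul_cancel_left₀ hn0]

/-- `∂(fω) = 0`, in coordinates. -/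
theorem IsWeakSecondEinstein.wirtinger_mul_coeff_symm {z : CSpace n} (hz : z ∈ φ.target)
    (m i j : Fin n) :
    (f (φ.symm z) : ℂ) * wirtinger m (h.coeff φ i j) z
        + h.coeff φ i j z * wirtinger m (fun w => (f (φ.symm w) : ℂ)) z
      = (f (φ.symm z) : ℂ) * wirtinger i (h.coeff φ m j) z
        + h.coeff φ m j z * wirtinger i (fun w => (f (φ.symm w) : ℂ)) z := by
  have hf := (hE.contDiffOn hbal hn hφ).differentiableAt_of_mem φ.open_target hz
  have key (m i : Fin n) : (f (φ.symm z) : ℂ) * wirtinger m (h.coeff φ i j) z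
      + h.coeff φ i j z * wirtinger m (fun w => (f (φ.symm w) : ℂ)) z
      = 2 * wirtinger m (h.chernRicci1 φ i j) z := by
    have e : wirtingerLM m (fderiv ℝ (fun w => (2 : ℂ) * h.chernRicci1 φ i j w) z)
        = wirtingerLM m (fderiv ℝ (fun w => (f (φ.symm w) : ℂ) * h.coeff φ i j w) z) :=
      linearMap_fderiv_congr _ φ.open_target
        (fun w hw => hE.chernRicci1 hbal hn hφ hw i j) hz
    rw [linearMap_fderiv_mul _ hf (h.differentiableAt_coeff hφ hz i j)] at e
    simp only [wirtinger_eq]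
    rw [← e, fderiv_const_mul ((h.contDiffOn_chernRicci1 hφ i j).differentiableAt_of_mem
      φ.open_target hz), map_smul, smul_eq_mul]
  rw [key, key, h.wirtinger_chernRicci1_symm hφ hz]

/-- Trace `∂(fω) = 0` with the inverse metric. One side yields `n ∂_m f`, the other `∂_m f`, and the
terms carrying `f` cancel by the torsion identity, leaving `(n - 1) ∂_m f = 0`. -/
theorem IsWeakSecondEinstein.wirtinger_eq_zero {z : CSpace n} (hz : z ∈ φ.target) (m : Fin n) :
    wirtinger m (fun w => (f (φ.symm w) : ℂ)) z = 0 := by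
  set F : ℂ := (f (φ.symm z) : ℂ)
  set dF : Fin n → ℂ := fun m => wirtinger m (fun w => (f (φ.symm w) : ℂ)) z with hdF
  have hsum : ∑ i, ∑ j, h.invCoeff φ i j z * (F * wirtinger m (h.coeff φ i j) z
      + h.coeff φ i j z * dF m) = ∑ i, ∑ j, h.invCoeff φ i j z *
        (F * wirtinger i (h.coeff φ m j) z + h.coeff φ m j z * dF i) :=
    Finset.sum_congr rfl fun i _ => Finset.sum_congr rfl fun j _ => by
      rw [hE.wirtinger_mul_coeff_symm hbal hn hφ hz m i j]
  have h1 : ∑ i, ∑ j, h.invCoeff φ i j z * (F * wirtinger m (h.coeff φ i j) z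
      + h.coeff φ i j z * dF m)
      = F * ∑ i, ∑ j, h.invCoeff φ i j z * wirtinger m (h.coeff φ i j) z + n * dF m := by
    rw [← h.sum_sum_invCoeff_mul_coeff hφ hz]
    simp only [Finset.mul_sum, Finset.sum_mul, ← Finset.sum_add_distrib]
    exact Finset.sum_congr rfl fun i _ => Finset.sum_congr rfl fun j _ => by ring
  have h2 : ∑ i, ∑ j, h.invCoeff φ i j z *
      (F * wirtinger i (h.coeff φ m j) z + h.coeff φ m j z * dF i)
      = F * ∑ i, ∑ j, h.invCoeff φ i j z * wirtinger i (h.coeff φ m j) z + dF m := by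
    have : ∑ i, (∑ j, h.invCoeff φ i j z * h.coeff φ m j z) * dF i = dF m := by
      simp [h.sum_invCoeff_mul_coeff hφ hz]
    rw [← this]
    simp only [Finset.mul_sum, Finset.sum_mul, ← Finset.sum_add_distrib]
    exact Finset.sum_congr rfl fun i _ => Finset.sum_congr rfl fun j _ => by ring
  rw [h1, h2, hbal.torsionTrace_eq_zero hn hφ hz m] at hsum
  have h3 : ((n : ℂ) - 1) * dF m = 0 := by linear_combination hsum
  refine (mul_eq_zero.1 h3).resolve_left (sub_ne_zero.2 ?_)
  exact_mod_cast (by omega : n ≠ 1)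

theorem IsWeakSecondEinstein.fderiv_eq_zero {z : CSpace n} (hz : z ∈ φ.target) :
    fderiv ℝ (fun w => (f (φ.symm w) : ℂ)) z = 0 := by
  ext v
  -- Since `f` is real, `∂̄f` is the conjugate of `∂f`.
  have hbar (m : Fin n) : wirtingerBar m (fun w => (f (φ.symm w) : ℂ)) z = 0 := by
    have := conj_wirtinger m (fun w => (f (φ.symm w) : ℂ)) z
    simp only [Complex.conj_ofReal] at this
    rw [← this, hE.wirtinger_eq_zero hbal hn hφ hz, map_zero]
  rw [apply_eq_sum_wirtinger]
  simp [← wirtinger_eq, ← wirtingerBar_eq, hbar, hE.wirtinger_eq_zero hbal hn hφ hz]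

end WeakSecondEinstein

/-- The Einstein factor of a balanced metric is constant. -/
theorem IsWeakSecondEinstein.isLocallyConstant [IsManifold 𝓘(ℂ, CSpace n) ω M]
    {h : HermitianMetric n M} {f : M → ℝ} (hE : h.IsWeakSecondEinstein f) (hbal : h.IsBalanced)
    (hn : 2 ≤ n) : IsLocallyConstant f := by
  rw [IsLocallyConstant.iff_eventually_eq]
  intro x
  let φ := chartAt (CSpace n) x
  have hφ : φ ∈ holCharts n M := IsManifold.chart_mem_maximalAtlas x
  have hx : φ x ∈ φ.target := mem_chart_target _ x
  obtain ⟨r, hr, hball⟩ := Metric.isOpen_iff.1 φ.open_target (φ x) hx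
  have hconst (w : CSpace n) (hw : w ∈ Metric.ball (φ x) r) :
      (f (φ.symm w) : ℂ) = (f (φ.symm (φ x)) : ℂ) := by
    have hc : Convex ℝ (Metric.ball (φ x) r) := convex_ball _ _
    refine Metric.isOpen_ball.is_const_of_fderiv_eq_zero (𝕜 := ℝ)
      (f := fun w => (f (φ.symm w) : ℂ)) hc.isPreconnected ?_ ?_ hw (Metric.mem_ball_self hr)
    · exact fun y hy => ((hE.contDiffOn hbal hn hφ).differentiableAt_of_mem φ.open_target
        (hball hy)).differentiableWithinAt
    · exact fun y hy => hE.fderiv_eq_zero hbal hn hφ (hball hy)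
  have hsrc : φ.source ∈ nhds x := φ.open_source.mem_nhds (mem_chart_source _ x)
  filter_upwards [hsrc, (φ.continuousAt (mem_chart_source _ x)).preimage_mem_nhds
    (Metric.ball_mem_nhds _ hr)] with y hy hyr
  have := hconst (φ y) hyr
  rw [φ.left_inv hy, φ.left_inv (mem_chart_source _ x)] at this
  exact_mod_cast this

end HermitianMetric

end

/-! ### The dichotomy. -/

/-- For a balanced metric the first, third and fourth Chern-Ricci forms agree, so `2 Θ^(1) = f ω`.
As `Θ^(1)` is closed and `ω` is balanced, `f` is constant; if it is not zero, then `dω = 0`. -/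
theorem corollary1p7 {n : ℕ} (hn : 3 ≤ n) {M : Type*} [TopologicalSpace M] [T2Space M]
    [CompactSpace M] [ConnectedSpace M] [ChartedSpace (CSpace n) M]
    [IsManifold 𝓘(ℂ, CSpace n) ω M]
    (h : HermitianMetric n M) (hpluri : h.IsPluriclosed) (hbal : h.IsBalanced)
    (f : M → ℝ) (hf : ContMDiff 𝓘(ℝ, CSpace n) 𝓘(ℝ, ℝ) ∞ f)
    (hE : h.IsWeakSecondEinstein f) :
    Xor h.ChernScalar2Vanishes (h.IsKaehlerEinstein ∧ h.HasNonzeroScalar) := by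
  have hn2 : 2 ≤ n := by omega
  have hn0 : (n : ℂ) ≠ 0 := by exact_mod_cast (by omega : n ≠ 0)
  obtain ⟨x₀⟩ := (inferInstance : Nonempty M)
  have hconst (x : M) : f x = f x₀ :=
    (hE.isLocallyConstant hbal hn2).apply_eq_of_isPreconnected isPreconnected_univ
      (Set.mem_univ x) (Set.mem_univ x₀)
  by_cases hf0 : f x₀ = 0
  · have hs1 : ∀ φ ∈ holCharts n M, ∀ z ∈ φ.target, h.chernScalar1 φ z = 0 := fun φ hφ z hz => by
      have := hE.chernScalar1 hbal hn2 hφ hz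
      rw [hconst, hf0] at this
      simpa using this
    refine Or.inl ⟨fun φ hφ z hz => ?_, fun hK => ?_⟩
    · rw [hbal.chernScalar2_eq_chernScalar1 hn2 hφ hz, hs1 φ hφ z hz]
    · exact hK.2 _ (IsManifold.chart_mem_maximalAtlas x₀) _ (mem_chart_target _ x₀)
        (hs1 _ (IsManifold.chart_mem_maximalAtlas x₀) _ (mem_chart_target _ x₀))
  · have hF : ((f x₀ : ℝ) : ℂ) ≠ 0 := by exact_mod_cast hf0
    have hs1 : ∀ φ ∈ holCharts n M, ∀ z ∈ φ.target, h.chernScalar1 φ z ≠ 0 :=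
      fun φ hφ z hz h0 => by
        have := hE.chernScalar1 hbal hn2 hφ hz
        rw [hconst, h0, mul_zero] at this
        exact mul_ne_zero hn0 hF this.symm
    -- The Einstein constant `f x₀ / 2` is read off from `2 Θ^(1) = f ω`.
    refine Or.inr ⟨⟨⟨fun φ hφ z hz => ?_, f x₀ / 2, fun φ hφ z hz i j => ?_⟩, hs1⟩, fun h2 => ?_⟩
    · refine h.extDeriv_fundForm_eq_zero hφ hz fun m i j => ?_
      -- With `∂f = 0` the identity `∂(fω) = 0` reduces to `f ∂ω = 0`, and the nonzero constant
      -- cancels.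
      have := hE.wirtinger_mul_coeff_symm hbal hn2 hφ hz m i j
      rw [hE.wirtinger_eq_zero hbal hn2 hφ hz, hE.wirtinger_eq_zero hbal hn2 hφ hz, hconst] at this
      simp only [mul_zero, add_zero] at this
      exact mul_left_cancel₀ hF this
    · have := hE.chernRicci1 hbal hn2 hφ hz i j
      rw [hconst] at this
      push_cast
      linear_combination this / 2
    · refine hs1 _ (IsManifold.chart_mem_maximalAtlas x₀) _ (mem_chart_target _ x₀) ?_
      rw [← hbal.chernScalar2_eq_chernScalar1 hn2
        (IsManifold.chart_mem_maximalAtlas x₀) (mem_chart_target _ x₀)]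
      exact h2 _ (IsManifold.chart_mem_maximalAtlas x₀) _ (mem_chart_target _ x₀)
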